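/- Let $P(z)=p_nz^n+p_{n-1}z^{n-1}+\cdots+p_0$ be a complex polynomial of degree $n\ge 1$ ($p_n\neq 0$), and put $$c=\frac{p_{n-1}}{np_n},\qquad q=\frac{n+2}{2},\qquad \theta_j=\frac{2\pi j-\arg (p_n)}{n+2}\quad (j=0,\dots,n+1),$$ where $-\pi<\arg(p_n)\le\pi$. Let $e_n(r)=r^{-2}$ if $n>2$, $e_2(r)=r^{-2}\log r$, and $e_1(r)=r^{-3/2}$. For $R>0$ and $C>0$ let $$\Lambda_j=\{z=re^{i\theta}:\ r>R,\ |\theta-\theta_j|<C\,e_n(r)\},\qquad \Lambda_{j,c}=\{z:\ z+c\in\Lambda_j\}.$$ There are positive constants $C=C(n,R)$, depending only on $n$ and $R$, such that for every such $P$ and every nontrivial (i.e. not identically zero) entire solution $f$ of $f''+P(z)f=0$ the following holds for all sufficiently large $R$ (how large may depend on $P$ and $f$), with $\Lambda_{j,c}$ formed with $R$ and $C=C(n,R)$. All but at most finitely many zeros of $f$ lie in $\bigcup_{j=0}^{n+1}\Lambda_{j,c}$. Moreover, for each $j\in\{0,\dots,n+1\}$ such that $f$ has infinitely many zeros in $\Lambda_{j,c}$,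 $$n(r,\Lambda_{j,c},1/f)=\frac{\sqrt{|p_n|}}{q\pi}\,r^{q}(1+o(1)),\qquad N(r,\Lambda_{j,c},1/f)=\frac{\sqrt{|p_n|}}{q^2\pi}\,r^{q}(1+o(1)),\qquad r\to\infty.$$ Here $n(r,\Lambda_{j,c},1/f)$ is the number of zeros of $f$ in $\Lambda_{j,c}$ with $|z|\le r$, counted with multiplicity, and $N(r,\Lambda_{j,c},1/f)=\int_0^r\frac{n(t,\Lambda_{j,c},1/f)-n(0,\Lambda_{j,c},1/f)}{t}\,dt+n(0,\Lambda_{j,c},1/f)\log r$ is the integrated counting function. -/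

import Mathlib

open Filter Asymptotics

noncomputable section

/-- `f` is a nontrivial entire solution of `f'' + P f = 0` on the complex plane. -/
structure IsNontrivialSolution (P : Polynomial ℂ) (f : ℂ → ℂ) : Prop where
  entire : Differentiable ℂ f
  ode : ∀ z : ℂ, deriv (deriv f) z + P.eval z * f z = 0
  nontrivial : ∃ z : ℂ, f z ≠ 0

/-- The rate `e_n(r)`, for `n ≥ 1`. -/
def rate (n : ℕ) (r : ℝ) : ℝ :=
  if 2 < n then r ^ (-2 : ℝ)
  else if n = 2 then r ^ (-2 : ℝ) * Real.log r
  else r ^ (-(3 / 2) : ℝ)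

/-- The critical angle `θ_j = (2πj - arg p_n) / (n + 2)`, with `-π < arg p_n ≤ π`,
where `n` is the degree and `p_n` the leading coefficient of `P`. -/
def criticalAngle (P : Polynomial ℂ) (j : ℕ) : ℝ :=
  (2 * Real.pi * j - Complex.arg P.leadingCoeff) / (P.natDegree + 2)

/-- The shift `c = p_{n-1} / (n p_n)`, where `n ≥ 1` is the degree of `P`. -/
def criticalShift (P : Polynomial ℂ) : ℂ :=
  P.coeff (P.natDegree - 1) / (P.natDegree * P.leadingCoeff)

/-- The domain `Λ_j = {r e^{iθ} : r > R, |θ - θ_j| < C e_n(r)}`, used for `R > 0`. -/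
def thinDomain (P : Polynomial ℂ) (C R : ℝ) (j : ℕ) : Set ℂ :=
  {z | ∃ r θ : ℝ, z = r * Complex.exp (θ * Complex.I) ∧ R < r ∧
    |θ - criticalAngle P j| < C * rate P.natDegree r}

/-- The translated domain `Λ_{j,c} = {z : z + c ∈ Λ_j}`. -/
def shiftedThinDomain (P : Polynomial ℂ) (C R : ℝ) (j : ℕ) : Set ℂ :=
  {z | z + criticalShift P ∈ thinDomain P C R j}

/-- `n(r, S, 1/f)`: the number of zeros `z` of the entire function `f` with `z ∈ S` and
`|z| ≤ r`, counted with multiplicity. (The order of vanishing is `0` where `f z ≠ 0`.) -/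
def zeroCount (f : ℂ → ℂ) (S : Set ℂ) (r : ℝ) : ℝ :=
  ∑ᶠ z ∈ S ∩ Metric.closedBall (0 : ℂ) r, (analyticOrderNatAt f z : ℝ)

/-- `N(r, S, 1/f)`: the integrated counting function
`∫₀ʳ (n(t, S, 1/f) - n(0, S, 1/f)) / t dt + n(0, S, 1/f) log r`. -/
def integratedZeroCount (f : ℂ → ℂ) (S : Set ℂ) (r : ℝ) : ℝ :=
  (∫ t in (0 : ℝ)..r, (zeroCount f S t - zeroCount f S 0) / t) + zeroCount f S 0 * Real.log r

end

/-! Substitute `z + c = κ ζ^a` with `a = 2/(n+2)` and `κ^(n+2) a² p_n = 1`. The Liouville transform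
`G(ζ) = ζ^((1-a)/2) f(z)` solves `G'' + (1 + φ) G = 0`. The shift by `c` removes the coefficient of
order `n - 1`, whence `φ = O(|ζ|^(-δ))` with `δ = 4/(n+2)` (`exists_isOscillator`). The `n + 2`
admissible `κ` point along the critical rays, and the corresponding images of the closed right
half-plane cover the plane (`exists_mem_sector`).

In the right half-plane the distant zeros of `G` imitate those of a sine: each is followed by
another at displacement `π + O(|ζ|^(-δ))` (`exists_next_zero`), no other zero is near it
(`ne_zero_of_near`), and the segment joining two of them is not steep (`abs_im_sub_le_abs_re_sub`).
Chains of successors must therefore merge, so up to finitely many points there is at most one chain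
`s k` (`exists_chain`).

Summing the steps gives `s k ~ π k` and `Im (s k) = O(1 + ∑ i^(-δ))`. The cases `δ > 1`, `δ = 1`, `δ
< 1` turn this into the three rates `e_n` for `arg (s k)` (`chain_arg_le`). Since `|z|^q ~ |κ|^q
|ζ|`, counting the `s k` yields both asymptotic formulas. The constant in the angular bound depends
on `P` and `f`, but so may the threshold for `R`; a `C(n, R)` that grows with `R` absorbs it. -/

/-- `G` solves `G'' + (1 + φ) G = 0` on `U`, with derivative `G₁` and without multiple zeros. -/
structure IsOscillator (φ G G₁ : ℂ → ℂ) (U : Set ℂ) : Prop where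
  hasDerivAt : ∀ ζ ∈ U, HasDerivAt G (G₁ ζ) ζ
  hasDerivAt_deriv : ∀ ζ ∈ U, HasDerivAt G₁ (-((1 + φ ζ) * G ζ)) ζ
  deriv_ne_zero : ∀ ζ ∈ U, G ζ = 0 → G₁ ζ ≠ 0

/-! ### Elementary estimates for the sine and for Gronwall's bound -/

theorem div_four_le_sin {x : ℝ} (h0 : 0 ≤ x) (h2 : x ≤ 2) : x / 4 ≤ Real.sin x := by
  have hpi := Real.pi_gt_three
  have hpi4 := Real.pi_le_four
  have key : ∀ y : ℝ, 0 ≤ y → y ≤ Real.pi / 2 → y / 2 ≤ Real.sin y := by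
    intro y hy hy'
    refine le_trans ?_ (Real.mul_le_sin hy hy')
    rw [div_mul_eq_mul_div, le_div_iff₀ Real.pi_pos]
    nlinarith
  rcases le_total x (Real.pi / 2) with h | h
  · linarith [key x h0 h]
  · have := key (Real.pi - x) (by linarith) (by linarith)
    rw [Real.sin_pi_sub] at this
    linarith

/-- This rests on `|sin w|² = sin² (Re w) + sinh² (Im w)`. The strip is narrower than `π` on either
side, so `0` is the only zero of the sine in it. -/
theorem norm_div_four_le_norm_sin {w : ℂ} (hw : |w.re| ≤ 2) : ‖w‖ / 4 ≤ ‖Complex.sin w‖ := by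
  have hsq : ‖Complex.sin w‖ ^ 2 = Real.sin w.re ^ 2 + Real.sinh w.im ^ 2 := by
    rw [Complex.sq_norm, Complex.normSq_apply]
    have h1 : Complex.sin w = (Real.sin w.re * Real.cosh w.im : ℝ) +
        (Real.cos w.re * Real.sinh w.im : ℝ) * Complex.I := by
      rw [Complex.sin_eq]; push_cast; ring
    have h2 : (Complex.sin w).re = Real.sin w.re * Real.cosh w.im := by
      rw [h1]; simp only [Complex.add_re, Complex.re_ofReal_mul, Complex.ofReal_re, Complex.I_re,
        mul_zero, add_zero]
    have h3 : (Complex.sin w).im = Real.cos w.re * Real.sinh w.im := by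
      rw [h1]; simp only [Complex.add_im, Complex.im_ofReal_mul, Complex.ofReal_im, Complex.I_im,
        mul_one, zero_add]
    rw [h2, h3]
    have h4 := Real.cosh_sq w.im
    have h5 := Real.sin_sq_add_cos_sq w.re
    calc _ = Real.sin w.re ^ 2 * Real.cosh w.im ^ 2 + Real.cos w.re ^ 2 * Real.sinh w.im ^ 2 := by
          ring
      _ = Real.sin w.re ^ 2 + (Real.sin w.re ^ 2 + Real.cos w.re ^ 2) * Real.sinh w.im ^ 2 := by
          rw [h4]; ring
      _ = _ := by rw [h5, one_mul]
  have hre : (w.re / 4) ^ 2 ≤ Real.sin w.re ^ 2 := by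
    rw [sq_le_sq]
    rcases le_total 0 w.re with h | h
    · rw [abs_of_nonneg h] at hw
      have := div_four_le_sin h hw
      rw [abs_of_nonneg (by positivity)]
      exact this.trans (le_abs_self _)
    · rw [abs_of_nonpos h] at hw
      have := div_four_le_sin (neg_nonneg.2 h) hw
      rw [Real.sin_neg] at this
      rw [abs_of_nonpos (by linarith)]
      exact (by linarith : -(w.re / 4) ≤ -Real.sin w.re).trans (neg_le_abs _)
  have him : w.im ^ 2 ≤ Real.sinh w.im ^ 2 := by
    rw [sq_le_sq, Real.abs_sinh]
    exact Real.self_le_sinh_iff.2 (abs_nonneg _)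
  refine le_of_sq_le_sq ?_ (norm_nonneg _)
  rw [hsq, div_pow, Complex.sq_norm, Complex.normSq_apply]
  nlinarith

theorem norm_sin_le_exp_norm (z : ℂ) : ‖Complex.sin z‖ ≤ Real.exp ‖z‖ := by
  have h1 := Complex.norm_exp_le_exp_norm (-z * Complex.I)
  have h2 := Complex.norm_exp_le_exp_norm (z * Complex.I)
  simp only [norm_mul, norm_neg, Complex.norm_I, mul_one] at h1 h2
  rw [Complex.sin, norm_div, norm_mul, Complex.norm_I, Complex.norm_two, mul_one]
  linarith [norm_sub_le (Complex.exp (-z * Complex.I)) (Complex.exp (z * Complex.I))]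

/-- Linearity in `t` matters: the error of the sine approximation must vanish at the zero itself, so
that it can be compared with `|sin w| ≥ ‖w‖ / 4` for arbitrarily small `w`. -/
theorem gronwallBound_zero_two_le {E t : ℝ} (hE : 0 ≤ E) (ht0 : 0 ≤ t) (ht : t ≤ 4) :
    gronwallBound 0 2 E t ≤ E * t * Real.exp 8 := by
  rw [gronwallBound_of_K_ne_0 two_ne_zero]
  have h1 : Real.exp (2 * t) - 1 ≤ 2 * t * Real.exp (2 * t) := by
    have h := Real.add_one_le_exp (-(2 * t))
    have h2 : Real.exp (2 * t) * Real.exp (-(2 * t)) = 1 := by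
      rw [← Real.exp_add]; simp
    nlinarith [Real.exp_pos (2 * t)]
  have h3 : Real.exp (2 * t) ≤ Real.exp 8 := Real.exp_le_exp.2 (by linarith)
  have h4 : Real.exp (2 * t) - 1 ≤ 2 * t * Real.exp 8 :=
    h1.trans (mul_le_mul_of_nonneg_left h3 (by linarith))
  have := mul_le_mul_of_nonneg_left h4 (by linarith : 0 ≤ E / 2)
  simp only [zero_mul, zero_add]
  linarith

/-! ### Zeros of a perturbed oscillator -/

namespace IsOscillator

variable {φ G G₁ : ℂ → ℂ} {U : Set ℂ}

/-- Near a zero, a solution is close to the sine function. -/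
theorem norm_sub_sin_le (h : IsOscillator φ G G₁ U) {ζ w : ℂ} {ε : ℝ} (hε : ε ≤ 1)
    (hU : ∀ u : ℂ, ‖u‖ ≤ 4 → ζ + u ∈ U ∧ ‖φ (ζ + u)‖ ≤ ε) (h0 : G ζ = 0) (hw : ‖w‖ ≤ 4) :
    ‖G (ζ + w) - G₁ ζ * Complex.sin w‖ ≤ Real.exp 12 * ε * ‖w‖ * ‖G₁ ζ‖ := by
  rcases eq_or_ne w 0 with rfl | hw0
  · simp [h0]
  have hwpos : 0 < ‖w‖ := norm_pos_iff.2 hw0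
  have hε0 : 0 ≤ ε := (norm_nonneg _).trans (hU 0 (by simp)).2
  obtain ⟨v, hv1, hwv⟩ : ∃ v : ℂ, ‖v‖ = 1 ∧ (‖w‖ : ℂ) * v = w := by
    refine ⟨w / ‖w‖, ?_, ?_⟩
    · rw [norm_div, Complex.norm_real, norm_norm, div_self hwpos.ne']
    · have : (‖w‖ : ℂ) ≠ 0 := by exact_mod_cast hwpos.ne'
      field_simp
  have hline : ∀ t ∈ Set.Icc (0 : ℝ) 4, ζ + t * v ∈ U ∧ ‖φ (ζ + t * v)‖ ≤ ε := by
    intro t ht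
    apply hU
    rw [norm_mul, hv1, Complex.norm_real, Real.norm_of_nonneg ht.1, mul_one]
    exact ht.2
  have hlin : ∀ t : ℝ, HasDerivAt (fun t : ℝ => ζ + t * v) v t := by
    intro t
    simpa using ((Complex.ofRealCLM.hasDerivAt (x := t)).mul_const v).const_add ζ
  have hlin0 : ∀ t : ℝ, HasDerivAt (fun t : ℝ => (t : ℂ) * v) v t := by
    intro t
    simpa using ((Complex.ofRealCLM.hasDerivAt (x := t)).mul_const v)
  -- Along the ray from `ζ` in direction `v`, `F` is a trajectory of the first-order system `V`, and
  -- `S` is an approximate one with the same initial value.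
  set F : ℝ → ℂ × ℂ := fun t => (G (ζ + t * v), G₁ (ζ + t * v)) with hF
  set S : ℝ → ℂ × ℂ :=
    fun t => (G₁ ζ * Complex.sin (t * v), G₁ ζ * Complex.cos (t * v)) with hS
  set V : ℝ → ℂ × ℂ → ℂ × ℂ :=
    fun t p => (v * p.2, -((1 + φ (ζ + t * v)) * v * p.1)) with hV
  have hFd : ∀ t ∈ Set.Icc (0 : ℝ) 4, HasDerivAt F (V t (F t)) t := by
    intro t ht
    have h1 := (h.hasDerivAt _ (hline t ht).1).comp t (hlin t)
    have h2 := (h.hasDerivAt_deriv _ (hline t ht).1).comp t (hlin t)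
    have e : V t (F t) = (G₁ (ζ + t * v) * v, -((1 + φ (ζ + t * v)) * G (ζ + t * v)) * v) := by
      refine Prod.ext (mul_comm v _) ?_
      change -((1 + φ (ζ + t * v)) * v * G (ζ + t * v)) = _
      ring
    rw [e]
    exact h1.prodMk h2
  have hSd : ∀ t : ℝ, HasDerivAt S
      (G₁ ζ * (Complex.cos (t * v) * v), G₁ ζ * (-Complex.sin (t * v) * v)) t := by
    intro t
    have h1 := ((Complex.hasDerivAt_sin _).comp t (hlin0 t)).const_mul (G₁ ζ)
    have h2 := ((Complex.hasDerivAt_cos _).comp t (hlin0 t)).const_mul (G₁ ζ)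
    exact h1.prodMk h2
  have hLip : ∀ t ∈ Set.Ico (0 : ℝ) 4, LipschitzOnWith 2 (V t) Set.univ := by
    intro t ht
    refine LipschitzOnWith.of_dist_le_mul fun p _ p' _ => ?_
    have hp : ‖1 + φ (ζ + t * v)‖ ≤ 2 := by
      refine (norm_add_le _ _).trans ?_
      rw [norm_one]
      linarith [(hline t ⟨ht.1, ht.2.le⟩).2]
    rw [dist_eq_norm, dist_eq_norm]
    have h1 := norm_fst_le (p - p')
    have h2 := norm_snd_le (p - p')
    have h3 := norm_nonneg (p - p')
    refine (Prod.norm_def _).le.trans (max_le ?_ ?_)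
    · have : (V t p - V t p').1 = v * (p - p').2 := by simp [hV]; ring
      rw [this, norm_mul, hv1, NNReal.coe_ofNat]
      linarith
    · have : (V t p - V t p').2 = -((1 + φ (ζ + t * v)) * v * (p - p').1) := by
        simp [hV]; ring
      rw [this, norm_neg, norm_mul, norm_mul, hv1, NNReal.coe_ofNat, mul_one]
      exact mul_le_mul hp h1 (norm_nonneg _) zero_le_two
  -- The defect of the sine is the term containing `φ`; `exp 4` bounds the sine on the disc of
  -- radius 4. With the `exp 8` from Gronwall this makes `exp 12`.
  have hbound : ∀ t ∈ Set.Ico (0 : ℝ) 4,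
      dist (G₁ ζ * (Complex.cos (t * v) * v), G₁ ζ * (-Complex.sin (t * v) * v)) (V t (S t)) ≤
        ε * Real.exp 4 * ‖G₁ ζ‖ := by
    intro t ht
    rw [dist_eq_norm]
    have hE : (G₁ ζ * (Complex.cos (t * v) * v), G₁ ζ * (-Complex.sin (t * v) * v)) - V t (S t) =
        (0, φ (ζ + t * v) * v * (G₁ ζ * Complex.sin (t * v))) := by
      simp only [hV, hS, Prod.mk_sub_mk, Prod.mk.injEq]
      constructor <;> ring
    rw [hE]
    have hsin : ‖Complex.sin (t * v)‖ ≤ Real.exp 4 := by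
      refine (norm_sin_le_exp_norm _).trans (Real.exp_le_exp.2 ?_)
      rw [norm_mul, hv1, Complex.norm_real, Real.norm_of_nonneg ht.1, mul_one]
      exact ht.2.le
    refine (Prod.norm_def _).le.trans (max_le ?_ ?_)
    · simp only [norm_zero]; positivity
    · simp only [norm_mul, hv1, mul_one]
      calc _ = ‖φ (ζ + t * v)‖ * ‖Complex.sin (t * v)‖ * ‖G₁ ζ‖ := by ring
        _ ≤ _ := by
          gcongr
          exact (hline t ⟨ht.1, ht.2.le⟩).2
  have hmain := dist_le_of_approx_trajectories_ODE_of_mem (v := V) (s := fun _ => Set.univ)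
    (f := F) (g := S) (f' := fun t => V t (F t)) (εf := 0) (δ := 0) (a := 0) (b := 4)
    hLip (fun t ht => (hFd t ht).continuousAt.continuousWithinAt)
    (fun t ht => (hFd t ⟨ht.1, ht.2.le⟩).hasDerivWithinAt) (fun t _ => by simp)
    (fun _ _ => trivial) (fun t _ => (hSd t).continuousAt.continuousWithinAt)
    (fun t _ => (hSd t).hasDerivWithinAt) hbound (fun _ _ => trivial)
    (by simp [hF, hS, h0]) ‖w‖ ⟨norm_nonneg _, hw⟩
  rw [zero_add, sub_zero, dist_eq_norm] at hmain
  have h1 : ‖G (ζ + w) - G₁ ζ * Complex.sin w‖ ≤ ‖F ‖w‖ - S ‖w‖‖ := by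
    have := norm_fst_le (F ‖w‖ - S ‖w‖)
    simpa only [hF, hS, Prod.mk_sub_mk, hwv] using this
  refine h1.trans (hmain.trans ?_)
  refine (gronwallBound_zero_two_le (by positivity) (norm_nonneg _) hw).trans (le_of_eq ?_)
  rw [show (12 : ℝ) = 4 + 8 by norm_num, Real.exp_add]
  ring

/-- Zeros are isolated from each other on the scale of `π`. -/
theorem ne_zero_of_near (h : IsOscillator φ G G₁ U) {ζ w : ℂ} {ε : ℝ}
    (hε : Real.exp 12 * ε ≤ 1 / 1000)
    (hU : ∀ u : ℂ, ‖u‖ ≤ 4 → ζ + u ∈ U ∧ ‖φ (ζ + u)‖ ≤ ε) (h0 : G ζ = 0) (hw : ‖w‖ ≤ 4)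
    (hre : |w.re| ≤ 2) (hw0 : w ≠ 0) : G (ζ + w) ≠ 0 := by
  intro hz
  have hε0 : 0 ≤ ε := (norm_nonneg _).trans (hU 0 (by simp)).2
  have hε1 : ε ≤ 1 := by nlinarith [Real.add_one_le_exp (12 : ℝ)]
  have h1 := h.norm_sub_sin_le hε1 hU h0 hw
  have hd : 0 < ‖G₁ ζ‖ := norm_pos_iff.2 (h.deriv_ne_zero ζ (by simpa using (hU 0 (by simp)).1) h0)
  have h2 := norm_div_four_le_norm_sin hre
  have hwpos : 0 < ‖w‖ := norm_pos_iff.2 hw0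
  rw [hz, zero_sub, norm_neg, norm_mul, mul_comm] at h1
  have h3 := le_of_mul_le_mul_right h1 hd
  nlinarith

/-- Each zero is followed by another one at distance about `π`. -/
theorem exists_next_zero (h : IsOscillator φ G G₁ U) {ζ : ℂ} {ε : ℝ}
    (hεpos : 0 < ε) (hε : Real.exp 12 * ε ≤ 1 / 1000)
    (hU : ∀ u : ℂ, ‖u‖ ≤ 4 → ζ + u ∈ U ∧ ‖φ (ζ + u)‖ ≤ ε) (h0 : G ζ = 0) :
    ∃ ζ' : ℂ, G ζ' = 0 ∧ ‖ζ' - ζ - Real.pi‖ ≤ 100 * (Real.exp 12 * ε) := by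
  set β := Real.exp 12 * ε with hβ
  have hβ0 : 0 < β := by positivity
  have hε1 : ε ≤ 1 := by nlinarith [Real.add_one_le_exp (12 : ℝ)]
  have hd : 0 < ‖G₁ ζ‖ := norm_pos_iff.2 (h.deriv_ne_zero ζ (by simpa using (hU 0 (by simp)).1) h0)
  have hpi : ‖(Real.pi : ℂ)‖ ≤ 3.2 := by
    rw [Complex.norm_real, Real.norm_of_nonneg Real.pi_pos.le]
    linarith [Real.pi_lt_d2]
  have hsmall : ∀ u : ℂ, ‖u‖ ≤ 100 * β → ‖(Real.pi : ℂ) + u‖ ≤ 4 := by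
    intro u hu
    linarith [norm_add_le (Real.pi : ℂ) u]
  have happ : ∀ u : ℂ, ‖u‖ ≤ 100 * β →
      ‖G (ζ + Real.pi + u) + G₁ ζ * Complex.sin u‖ ≤ 4 * β * ‖G₁ ζ‖ := by
    intro u hu
    have h1 := h.norm_sub_sin_le hε1 hU h0 (hsmall u hu)
    rw [add_comm (Real.pi : ℂ) u, Complex.sin_add_pi, add_comm u, ← add_assoc, mul_neg,
      sub_neg_eq_add] at h1
    refine h1.trans ?_
    have := mul_le_mul_of_nonneg_left (hsmall u hu) hβ0.le
    rw [← hβ, mul_comm 4]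
    gcongr
  have hG0 : ‖G (ζ + Real.pi)‖ ≤ 4 * β * ‖G₁ ζ‖ := by
    simpa using happ 0 (by simpa using by positivity)
  -- Quantitative open mapping. On this circle `|sin u| ≥ 25 β`, while the approximation error and
  -- the value at the centre are each at most `4 β` (in units of `‖G₁ ζ‖`), leaving `17 β`. The
  -- image then covers a ball of radius `17 β / 2 > 4 β` about the central value, hence contains
  -- `0`.
  have hsphere : ∀ z ∈ Metric.sphere (ζ + (Real.pi : ℂ)) (100 * β),
      17 * β * ‖G₁ ζ‖ ≤ ‖G z - G (ζ + Real.pi)‖ := by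
    intro z hz
    rw [mem_sphere_iff_norm] at hz
    set u := z - (ζ + Real.pi) with hu
    have hzu : z = ζ + Real.pi + u := by rw [hu]; ring
    have h1 := happ u hz.le
    have hre : |u.re| ≤ 2 := by
      refine (Complex.abs_re_le_norm u).trans ?_
      linarith
    have h2 := norm_div_four_le_norm_sin hre
    rw [hz] at h2
    have h3 : ‖G₁ ζ * Complex.sin u‖ ≤ ‖G (ζ + Real.pi + u) + G₁ ζ * Complex.sin u‖ +
        (‖G z - G (ζ + Real.pi)‖ + ‖G (ζ + Real.pi)‖) := by
      have e : G₁ ζ * Complex.sin u = (G (ζ + Real.pi + u) + G₁ ζ * Complex.sin u) -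
          ((G z - G (ζ + Real.pi)) + G (ζ + Real.pi)) := by rw [hzu]; ring
      calc _ = ‖_‖ := by rw [← e]
        _ ≤ _ := (norm_sub_le _ _).trans (by gcongr; exact norm_add_le _ _)
    rw [norm_mul] at h3
    nlinarith
  have hmem : ∀ u : ℂ, ‖u‖ ≤ 100 * β → ζ + Real.pi + u ∈ U := by
    intro u hu
    rw [add_assoc]
    exact (hU _ (hsmall u hu)).1
  have hdiff : DiffContOnCl ℂ G (Metric.ball (ζ + (Real.pi : ℂ)) (100 * β)) := by
    apply DifferentiableOn.diffContOnCl
    intro z hz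
    rw [closure_ball _ (by positivity), mem_closedBall_iff_norm] at hz
    have := hmem _ hz
    rw [add_sub_cancel] at this
    exact (h.hasDerivAt _ this).differentiableAt.differentiableWithinAt
  -- If `G` were constant near the centre, it would be constant up to the circle, against `hsphere`.
  have hfreq : ∃ᶠ z in nhds (ζ + (Real.pi : ℂ)), G z ≠ G (ζ + Real.pi) := by
    rw [Filter.Frequently]
    intro hev
    have hev' : G =ᶠ[nhds (ζ + (Real.pi : ℂ))] fun _ => G (ζ + Real.pi) := by
      filter_upwards [hev] with z hz
      simpa using hz
    have han : AnalyticOnNhd ℂ G (Metric.ball (ζ + (Real.pi : ℂ)) (100 * β)) :=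
      hdiff.differentiableOn.analyticOnNhd Metric.isOpen_ball
    have heq := han.eqOn_of_preconnected_of_eventuallyEq analyticOnNhd_const
      (convex_ball _ _).isPreconnected (Metric.mem_ball_self (by positivity)) hev'
    have hcl := heq.of_subset_closure hdiff.continuousOn continuousOn_const subset_closure
      (subset_refl _)
    rw [closure_ball _ (by positivity)] at hcl
    have hpt : ζ + (Real.pi : ℂ) + (100 * β : ℝ) ∈ Metric.sphere (ζ + (Real.pi : ℂ)) (100 * β) := by
      rw [mem_sphere_iff_norm, add_sub_cancel_left, Complex.norm_real,
        Real.norm_of_nonneg (by positivity)]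
    have h1 := hsphere _ hpt
    rw [hcl (Metric.sphere_subset_closedBall hpt), sub_self, norm_zero] at h1
    have : 0 < 17 * β * ‖G₁ ζ‖ := by positivity
    linarith
  have hball := hdiff.ball_subset_image_closedBall (by positivity) hsphere hfreq
  have h0mem : (0 : ℂ) ∈ Metric.ball (G (ζ + Real.pi)) (17 * β * ‖G₁ ζ‖ / 2) := by
    rw [mem_ball_iff_norm, zero_sub, norm_neg]
    have : 0 < β * ‖G₁ ζ‖ := by positivity
    linarith
  obtain ⟨ζ', hζ', hz⟩ := hball h0mem
  refine ⟨ζ', hz, ?_⟩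
  rw [mem_closedBall_iff_norm] at hζ'
  rwa [sub_sub]

/-- The segment between two zeros is not steep. -/
theorem abs_im_sub_le_abs_re_sub (h : IsOscillator φ G G₁ U) {a b : ℂ}
    (hU : ∀ t ∈ Set.Icc (0 : ℝ) 1, a + t * (b - a) ∈ U ∧ ‖φ (a + t * (b - a))‖ ≤ 1 / 2)
    (ha : G a = 0) (hb : G b = 0) : |(b - a).im| ≤ |(b - a).re| := by
  by_contra! hlt
  set v := b - a with hv
  have hv0 : v ≠ 0 := by
    rintro h0
    simp [h0] at hlt
  have hre : (v ^ 2).re < 0 := by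
    rw [sq, Complex.mul_re]
    have := sq_lt_sq.2 hlt
    nlinarith
  -- A steep segment has `Re v² < 0`, possibly tiny beside `|v²|`. The rotation `e = 1 ± i` pushes
  -- the real part below `-|v²|`, and `|e| / 2 < 1` leaves room for `|φ| ≤ 1/2`.
  obtain ⟨e, he1, he2, he3⟩ : ∃ e : ℂ, 0 < e.re ∧ ‖e‖ ^ 2 = 2 ∧ (e * v ^ 2).re ≤ -‖v ^ 2‖ := by
    have habs := Complex.norm_le_abs_re_add_abs_im (v ^ 2)
    rw [abs_of_neg hre] at habs
    rcases le_total 0 (v ^ 2).im with him | him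
    · refine ⟨1 + Complex.I, by simp, ?_, ?_⟩
      · rw [Complex.sq_norm, Complex.normSq_apply]; norm_num
      · rw [abs_of_nonneg him] at habs
        rw [Complex.mul_re]; simp; simp at habs; linarith
    · refine ⟨1 - Complex.I, by simp, ?_, ?_⟩
      · rw [Complex.sq_norm, Complex.normSq_apply]; norm_num
      · rw [abs_of_nonpos him] at habs
        rw [Complex.mul_re]; simp; simp at habs; linarith
  have hlin : ∀ t : ℝ, HasDerivAt (fun t : ℝ => a + t * v) v t := by
    intro t
    simpa using ((Complex.ofRealCLM.hasDerivAt (x := t)).mul_const v).const_add a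
  -- `H` vanishes at both ends, so Rolle applies. But `H' = Re e |G₁ v|² - Re (e v² (1 + φ)) |G|²`
  -- is a sum of two nonnegative terms, and it vanishes only where `G = G₁ = 0`.
  set H : ℝ → ℝ := fun t => (e * ((starRingEnd ℂ) (G (a + t * v)) * (G₁ (a + t * v) * v))).re
    with hH
  set H' : ℝ → ℝ := fun t => (e * ((starRingEnd ℂ) (G₁ (a + t * v) * v) * (G₁ (a + t * v) * v) +
    (starRingEnd ℂ) (G (a + t * v)) *
      (-((1 + φ (a + t * v)) * G (a + t * v)) * v * v))).re with hH'
  have hd : ∀ t ∈ Set.Icc (0 : ℝ) 1, HasDerivAt H (H' t) t := by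
    intro t ht
    have h1 := (h.hasDerivAt _ (hU t ht).1).comp t (hlin t)
    have h2 := ((h.hasDerivAt_deriv _ (hU t ht).1).comp t (hlin t)).mul_const v
    have h3 : HasDerivAt (fun t : ℝ => (starRingEnd ℂ) (G (a + t * v)))
        ((starRingEnd ℂ) (G₁ (a + t * v) * v)) t :=
      (Complex.conjCLE.toContinuousLinearMap.hasFDerivAt.comp_hasDerivAt t h1)
    have h4 := (h3.mul h2).const_mul e
    exact (Complex.reCLM.hasFDerivAt.comp_hasDerivAt t h4)
  have hends : H 0 = H 1 := by
    simp [hH, ha, hv, hb]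
  obtain ⟨t, ht, hzero⟩ := exists_hasDerivAt_eq_zero (f := H) (f' := H') zero_lt_one
    (fun t ht => (hd t ht).continuousAt.continuousWithinAt) hends
    (fun t ht => hd t ⟨ht.1.le, ht.2.le⟩)
  have htI : t ∈ Set.Icc (0 : ℝ) 1 := ⟨ht.1.le, ht.2.le⟩
  set g := G (a + t * v) with hg
  set g₁ := G₁ (a + t * v) with hg₁
  set p := φ (a + t * v) with hp
  have hpb : ‖p‖ ≤ 1 / 2 := (hU t htI).2
  have hexp : H' t = e.re * ‖g₁ * v‖ ^ 2 - (e * (v ^ 2) * (1 + p)).re * ‖g‖ ^ 2 := by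
    have e1 : (starRingEnd ℂ) (g₁ * v) * (g₁ * v) = ((‖g₁ * v‖ ^ 2 : ℝ) : ℂ) := by
      rw [mul_comm, Complex.mul_conj, Complex.normSq_eq_norm_sq]
    have e2 : (starRingEnd ℂ) g * g = ((‖g‖ ^ 2 : ℝ) : ℂ) := by
      rw [mul_comm, Complex.mul_conj, Complex.normSq_eq_norm_sq]
    have e3 : e * ((starRingEnd ℂ) (g₁ * v) * (g₁ * v) +
        (starRingEnd ℂ) g * (-((1 + p) * g) * v * v)) =
        e * ((‖g₁ * v‖ ^ 2 : ℝ) : ℂ) - e * v ^ 2 * (1 + p) * ((‖g‖ ^ 2 : ℝ) : ℂ) := by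
      rw [← e1, ← e2]; ring
    simp only [hH']
    rw [e3, Complex.sub_re, Complex.re_mul_ofReal, Complex.re_mul_ofReal]
  have hneg : (e * v ^ 2 * (1 + p)).re < 0 := by
    have h1 : (e * v ^ 2 * (1 + p)).re = (e * v ^ 2).re + (e * v ^ 2 * p).re := by
      rw [mul_add, mul_one, Complex.add_re]
    have h2 : (e * v ^ 2 * p).re ≤ ‖e‖ * ‖v ^ 2‖ * ‖p‖ := by
      refine (Complex.re_le_norm _).trans ?_
      rw [norm_mul, norm_mul]
    have hvp : 0 < ‖v ^ 2‖ := norm_pos_iff.2 (pow_ne_zero 2 hv0)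
    have h3 : ‖e‖ < 3 / 2 := by nlinarith [norm_nonneg e]
    have h4 : ‖e‖ * ‖v ^ 2‖ * ‖p‖ ≤ 3 / 2 * ‖v ^ 2‖ * (1 / 2) := by gcongr
    linarith
  have hgz : g = 0 := by
    by_contra hne
    have : 0 < ‖g‖ ^ 2 := by positivity
    have h5 : 0 ≤ e.re * ‖g₁ * v‖ ^ 2 := by positivity
    nlinarith
  have hg₁z : g₁ = 0 := by
    by_contra hne
    have h5 : 0 < e.re * ‖g₁ * v‖ ^ 2 := by
      have := mul_ne_zero hne hv0
      positivity
    rw [hgz] at hexp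
    simp only [norm_zero] at hexp
    nlinarith
  exact h.deriv_ne_zero _ (hU t htI).1 hgz hg₁z

end IsOscillator

/-! ### Chains of zeros -/

theorem abs_re_im_sub_pi_le {ζ ζ' : ℂ} {e : ℝ} (h : ‖ζ' - ζ - Real.pi‖ ≤ e) :
    |ζ'.re - ζ.re - Real.pi| ≤ e ∧ |ζ'.im - ζ.im| ≤ e := by
  have h1 := (Complex.abs_re_le_norm (ζ' - ζ - Real.pi)).trans h
  have h2 := (Complex.abs_im_le_norm (ζ' - ζ - Real.pi)).trans h
  simp at h1 h2
  exact ⟨h1, h2⟩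

/-- A set whose points have successors at distance about `π`, which is uniformly discrete and
asymptotically flat, consists of one chain up to finitely many points. -/
theorem exists_chain {Z : Set ℂ} {e : ℂ → ℝ} (hre : ∀ ζ ∈ Z, 0 ≤ ζ.re)
    (he : ∀ ζ ∈ Z, e ζ ≤ 1 / 10)
    (hnext : ∀ ζ ∈ Z, ∃ ζ' ∈ Z, ‖ζ' - ζ - Real.pi‖ ≤ e ζ)
    (hiso : ∀ ζ ∈ Z, ∀ ζ' ∈ Z, |(ζ' - ζ).re| ≤ 2 → |(ζ' - ζ).im| ≤ 2 → ζ' = ζ)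
    (hflat : ∃ ρ : ℝ, ∀ ζ ∈ Z, ∀ ζ' ∈ Z, ρ ≤ ζ.re → ρ ≤ ζ'.re →
      |(ζ' - ζ).im| ≤ |(ζ' - ζ).re|) (hZ : Z.Nonempty) :
    ∃ s : ℕ → ℂ, (∀ k, s k ∈ Z) ∧ (∀ k, ‖s (k + 1) - s k - Real.pi‖ ≤ e (s k)) ∧
      (Z \ Set.range s).Finite := by
  obtain ⟨ρ, hρ⟩ := hflat
  choose! N hNZ hN using hnext
  obtain ⟨ζ₀, hζ₀⟩ := hZ
  have hpi := Real.pi_gt_d2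
  have hpi' := Real.pi_lt_d2
  have hmaps : Set.MapsTo N Z Z := hNZ
  have hit : ∀ (k : ℕ) (ζ : ℂ), ζ ∈ Z → N^[k] ζ ∈ Z := fun k ζ hζ => hmaps.iterate k hζ
  have hstep : ∀ ζ ∈ Z, ζ.re + 3 ≤ (N ζ).re ∧ (N ζ).re ≤ ζ.re + 3.3 := by
    intro ζ hζ
    have := abs_le.1 ((abs_re_im_sub_pi_le (hN ζ hζ)).1.trans (he ζ hζ))
    constructor <;> linarith [this.1, this.2]
  have hgrow : ∀ (k : ℕ) (ζ : ℂ), ζ ∈ Z → ζ.re + 3 * k ≤ (N^[k] ζ).re := by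
    intro k ζ hζ
    induction k with
    | zero => simp
    | succ k ih =>
      rw [Function.iterate_succ_apply']
      have := (hstep _ (hit k ζ hζ)).1
      push_cast
      linarith
  -- Two points with a common successor differ by at most `1/5` in each coordinate, so `hiso`
  -- identifies them.
  have hinj : Set.InjOn N Z := by
    intro x hx y hy hxy
    have h1 := abs_re_im_sub_pi_le ((hN x hx).trans (he x hx))
    have h2 := abs_re_im_sub_pi_le ((hN y hy).trans (he y hy))
    rw [hxy] at h1
    obtain ⟨⟨a1, a2⟩, a3, a4⟩ := And.intro (abs_le.1 h1.1) (abs_le.1 h1.2)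
    obtain ⟨⟨b1, b2⟩, b3, b4⟩ := And.intro (abs_le.1 h2.1) (abs_le.1 h2.2)
    refine (hiso x hx y hy ?_ ?_).symm
    · rw [Complex.sub_re, abs_le]; constructor <;> linarith
    · rw [Complex.sub_im, abs_le]; constructor <;> linarith
  have hinjk : ∀ k : ℕ, Set.InjOn N^[k] Z := fun k => hinj.iterate hmaps k
  -- The orbit of `ζ₀` advances by at most `3.3 < 4` in real part, so far to the right one of its
  -- points lies within `2` of the given orbit in real part. Flatness bounds the imaginary
  -- difference as well, and isolation forces equality.
  have hmerge : ∀ η ∈ Z, ∃ m k : ℕ, N^[m] η = N^[k] ζ₀ := by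
    intro η hη
    obtain ⟨m, hm⟩ := exists_nat_gt (|ρ| + 4 + ζ₀.re)
    refine ⟨m, ?_⟩
    set y := N^[m] η with hy
    have hyZ : y ∈ Z := hit m η hη
    have hyre : |ρ| + 4 + ζ₀.re < y.re := by
      have h1 := hgrow m η hη
      have h2 := hre η hη
      have h3 : (0 : ℝ) ≤ m := m.cast_nonneg
      linarith
    have hex : ∃ k : ℕ, y.re < (N^[k] ζ₀).re := by
      obtain ⟨k, hk⟩ := exists_nat_gt y.re
      refine ⟨k, ?_⟩
      have h1 := hgrow k ζ₀ hζ₀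
      have h2 := hre ζ₀ hζ₀
      have h3 : (0 : ℝ) ≤ k := k.cast_nonneg
      linarith
    classical
    obtain ⟨k, hk, hmin⟩ : ∃ k : ℕ, y.re < (N^[k + 1] ζ₀).re ∧ (N^[k] ζ₀).re ≤ y.re := by
      have h0 : Nat.find hex ≠ 0 := by
        intro h0
        have := Nat.find_spec hex
        rw [h0] at this
        have h4 := abs_nonneg ρ
        simp only [Function.iterate_zero, id] at this
        linarith
      obtain ⟨k, hk⟩ := Nat.exists_eq_succ_of_ne_zero h0
      refine ⟨k, ?_, ?_⟩
      · have := Nat.find_spec hex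
        rwa [hk] at this
      · exact not_lt.1 (Nat.find_min hex (by omega : k < Nat.find hex))
    have hkZ := hit k ζ₀ hζ₀
    have hk1Z := hit (k + 1) ζ₀ hζ₀
    have hst := (hstep _ hkZ).2
    rw [← Function.iterate_succ_apply' N k ζ₀] at hst
    have hρy : ρ ≤ y.re := by linarith [le_abs_self ρ, hre ζ₀ hζ₀]
    have close : ∀ x ∈ Z, ρ ≤ x.re → |(y - x).re| ≤ 2 → y = x := by
      intro x hx hxρ hxy
      exact hiso x hx y hyZ hxy ((hρ x hx y hyZ hxρ hρy).trans hxy)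
    rcases le_total (y.re - (N^[k] ζ₀).re) 2 with h2 | h2
    · refine ⟨k, close _ hkZ ?_ ?_⟩
      · linarith [le_abs_self ρ, hre ζ₀ hζ₀]
      · rw [Complex.sub_re, abs_le]; constructor <;> linarith
    · refine ⟨k + 1, close _ hk1Z ?_ ?_⟩
      · linarith [le_abs_self ρ, hre ζ₀ hζ₀]
      · rw [Complex.sub_re, abs_le]; constructor <;> linarith
  refine ⟨fun k => N^[k] ζ₀, fun k => hit k ζ₀ hζ₀, fun k => ?_, ?_⟩
  · simp only [Function.iterate_succ_apply']
    exact hN _ (hit k ζ₀ hζ₀)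
  -- A point off the chain is a predecessor of `ζ₀`. Real parts are nonnegative and grow by `3` per
  -- step, which bounds its depth, and injectivity leaves one point per depth.
  · obtain ⟨M, hM⟩ := exists_nat_gt ζ₀.re
    have hfin : (⋃ d ∈ Finset.range (M + 1), {η ∈ Z | N^[d] η = ζ₀}).Finite := by
      refine Set.Finite.biUnion (Finset.finite_toSet _) fun d _ => Set.Subsingleton.finite ?_
      intro x hx y hy
      exact hinjk d hx.1 hy.1 (hx.2.trans hy.2.symm)
    refine hfin.subset ?_
    rintro η ⟨hη, hnot⟩
    obtain ⟨m, k, hmk⟩ := hmerge η hη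
    rcases le_total m k with hle | hle
    · exfalso
      apply hnot
      refine ⟨k - m, ?_⟩
      apply hinjk m (hit _ _ hζ₀) hη
      rw [hmk, ← Function.iterate_add_apply]
      congr 2
      omega
    · have heq : N^[m - k] η = ζ₀ := by
        apply hinjk k (hit _ _ hη) hζ₀
        rw [← hmk, ← Function.iterate_add_apply]
        congr 2
        omega
      have h1 := hgrow (m - k) η hη
      rw [heq] at h1
      have h2 := hre η hη
      have h3 : ((m - k : ℕ) : ℝ) < M := by
        have : (0 : ℝ) ≤ ((m - k : ℕ) : ℝ) := Nat.cast_nonneg _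
        linarith
      have h4 : m - k < M := by exact_mod_cast h3
      simp only [Set.mem_iUnion, Finset.mem_range]
      exact ⟨m - k, by omega, hη, heq⟩

/-- The zeros of `G` in the part `re + |im| ≥ ρ` of the right half-plane. -/
def rightZeros (G : ℂ → ℂ) (ρ : ℝ) : Set ℂ :=
  {ζ | 0 ≤ ζ.re ∧ ρ ≤ ζ.re + |ζ.im| ∧ G ζ = 0}

/-- If the perturbation decays, the distant zeros in the right half-plane form one chain. -/
theorem IsOscillator.exists_chain_rightZeros {φ G G₁ : ℂ → ℂ}
    (h : IsOscillator φ G G₁ Complex.slitPlane) {K δ ρ₀ : ℝ} (hK : 0 < K) (hδ : 0 < δ)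
    (hφ : ∀ ζ ∈ Complex.slitPlane, ρ₀ ≤ ‖ζ‖ → ‖φ ζ‖ ≤ K * ‖ζ‖ ^ (-δ)) :
    ∃ ρ K' : ℝ, 1 ≤ ρ ∧ 0 < K' ∧ (rightZeros G ρ = ∅ ∨ ∃ s : ℕ → ℂ, (∀ k, s k ∈ rightZeros G ρ) ∧
      (∀ k, ‖s (k + 1) - s k - Real.pi‖ ≤ 1 / 10) ∧
      (∀ k, ‖s (k + 1) - s k - Real.pi‖ ≤ K' * ‖s k‖ ^ (-δ)) ∧
      (rightZeros G ρ \ Set.range s).Finite) := by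
  have hlim : Tendsto (fun x : ℝ => Real.exp 12 * (K * x ^ (-δ))) atTop (nhds 0) := by
    simpa using ((tendsto_rpow_neg_atTop hδ).const_mul K).const_mul (Real.exp 12)
  obtain ⟨T₀, hT₀⟩ := (hlim.eventually (ge_mem_nhds (by norm_num : (0 : ℝ) < 1 / 1000))).exists_forall_of_atTop
  -- On `re + |im| ≥ 4 T` the modulus is at least `2 T`. A disc of radius 4 then stays at modulus at
  -- least `T`, where `φ` is small, and avoids the cut.
  set T := |T₀| + |ρ₀| + 10 with hT
  have hTT₀ : T₀ ≤ T := by linarith [le_abs_self T₀, abs_nonneg ρ₀]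
  have hTρ₀ : ρ₀ ≤ T := by linarith [le_abs_self ρ₀, abs_nonneg T₀]
  have hT10 : 10 ≤ T := by linarith [abs_nonneg ρ₀, abs_nonneg T₀]
  set Z := rightZeros G (4 * T) with hZ
  have hnorm : ∀ ζ ∈ Z, 2 * T ≤ ‖ζ‖ := by
    rintro ζ ⟨h1, h2, -⟩
    have := Complex.abs_re_le_norm ζ
    have := Complex.abs_im_le_norm ζ
    rw [abs_of_nonneg h1] at *
    linarith
  have hεb : ∀ ζ ∈ Z, Real.exp 12 * (K * (‖ζ‖ / 2) ^ (-δ)) ≤ 1 / 1000 := by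
    intro ζ hζ
    exact hT₀ _ (by linarith [hnorm ζ hζ])
  have hloc : ∀ ζ ∈ Z, ∀ u : ℂ, ‖u‖ ≤ 4 →
      ζ + u ∈ Complex.slitPlane ∧ ‖φ (ζ + u)‖ ≤ K * (‖ζ‖ / 2) ^ (-δ) := by
    intro ζ hζ u hu
    have hn := hnorm ζ hζ
    have hmem : ζ + u ∈ Complex.slitPlane := by
      rw [Complex.mem_slitPlane_iff]
      by_contra! hcon
      rw [Complex.add_re, Complex.add_im] at hcon
      have h1 := abs_le.1 ((Complex.abs_re_le_norm u).trans hu)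
      have h2 := abs_le.1 ((Complex.abs_im_le_norm u).trans hu)
      have h3 := Complex.norm_le_abs_re_add_abs_im ζ
      rw [abs_of_nonneg hζ.1] at h3
      have h4 : |ζ.im| ≤ 4 := by rw [abs_le]; constructor <;> linarith [hcon.2, h2.1, h2.2]
      linarith [hcon.1, h1.1]
    have hn2 : ‖ζ‖ / 2 ≤ ‖ζ + u‖ := by
      have := norm_sub_le (ζ + u) u
      rw [add_sub_cancel_right] at this
      linarith
    refine ⟨hmem, (hφ _ hmem (by linarith)).trans ?_⟩
    exact mul_le_mul_of_nonneg_left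
      (Real.rpow_le_rpow_of_nonpos (by linarith) hn2 (by linarith)) hK.le
  refine ⟨4 * T, 100 * Real.exp 12 * K * 2 ^ δ, by linarith, by positivity, ?_⟩
  rcases Z.eq_empty_or_nonempty with hempty | hne
  · exact Or.inl hempty
  right
  have hεeq : ∀ ζ : ℂ, 100 * (Real.exp 12 * (K * (‖ζ‖ / 2) ^ (-δ))) =
      100 * Real.exp 12 * K * 2 ^ δ * ‖ζ‖ ^ (-δ) := by
    intro ζ
    rw [Real.div_rpow (norm_nonneg _) zero_le_two, Real.rpow_neg zero_le_two, div_inv_eq_mul]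
    ring
  have hε10 : ∀ ζ ∈ Z, 100 * Real.exp 12 * K * 2 ^ δ * ‖ζ‖ ^ (-δ) ≤ 1 / 10 := by
    intro ζ hζ
    rw [← hεeq]
    linarith [hεb ζ hζ]
  refine Exists.imp (fun s hs => ⟨hs.1, fun k => (hs.2.1 k).trans (hε10 _ (hs.1 k)), hs.2⟩)
    (exists_chain (Z := Z) (e := fun ζ => 100 * Real.exp 12 * K * 2 ^ δ * ‖ζ‖ ^ (-δ))
      (fun ζ hζ => hζ.1) hε10 ?_ ?_ ?_ hne)
  · intro ζ hζ
    have hζ0 : 0 < ‖ζ‖ := by linarith [hnorm ζ hζ]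
    obtain ⟨ζ', hz, hd⟩ := h.exists_next_zero (ζ := ζ) (by positivity) (hεb ζ hζ) (hloc ζ hζ) hζ.2.2
    rw [hεeq] at hd
    refine ⟨ζ', ⟨?_, ?_, hz⟩, hd⟩
    · have := abs_le.1 (abs_re_im_sub_pi_le (hd.trans (hε10 ζ hζ))).1
      linarith [this.1, Real.pi_gt_three, hζ.1]
    -- The region `re + |im| ≥ ρ` is stable under succession: the real part gains more than `|im|`
    -- can lose.
    · obtain ⟨h1, h2⟩ := abs_re_im_sub_pi_le (hd.trans (hε10 ζ hζ))
      have h3 := abs_sub_abs_le_abs_sub ζ.im ζ'.im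
      rw [abs_sub_comm] at h3
      linarith [(abs_le.1 h1).1, Real.pi_gt_three, hζ.2.1]
  · intro ζ hζ ζ' hζ' h1 h2
    by_contra hne
    have hn : ‖ζ' - ζ‖ ≤ 4 := (Complex.norm_le_abs_re_add_abs_im _).trans (by linarith)
    apply h.ne_zero_of_near (hεb ζ hζ) (hloc ζ hζ) hζ.2.2 hn h1 (sub_ne_zero.2 hne)
    rw [add_sub_cancel]
    exact hζ'.2.2
  · refine ⟨T, fun ζ hζ ζ' hζ' h1 h2 => ?_⟩
    refine h.abs_im_sub_le_abs_re_sub (fun t ht => ?_) hζ.2.2 hζ'.2.2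
    have hre : T ≤ (ζ + t * (ζ' - ζ)).re := by
      rw [Complex.add_re, Complex.re_ofReal_mul, Complex.sub_re]
      nlinarith [ht.1, ht.2]
    have hn : T ≤ ‖ζ + t * (ζ' - ζ)‖ := hre.trans (Complex.re_le_norm _)
    have hmem : ζ + t * (ζ' - ζ) ∈ Complex.slitPlane := Or.inl (by linarith)
    refine ⟨hmem, (hφ _ hmem (by linarith)).trans ?_⟩
    have h3 := hT₀ _ (hTT₀.trans hn)
    have h4 : 0 ≤ K * ‖ζ + t * (ζ' - ζ)‖ ^ (-δ) := by positivity
    nlinarith [Real.add_one_le_exp (12 : ℝ)]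

/-! ### Asymptotics of a chain -/

/-- Induction by Bernoulli's inequality `(1 - 1/x)^(1-δ) ≤ 1 - (1-δ)/x` with `x = k + 1`. -/
theorem sum_rpow_neg_le {δ : ℝ} (h0 : 0 ≤ δ) (h1 : δ < 1) (k : ℕ) :
    ∑ i ∈ Finset.range k, ((i : ℝ) + 1) ^ (-δ) ≤ (k : ℝ) ^ (1 - δ) / (1 - δ) := by
  have hd : 0 < 1 - δ := by linarith
  induction k with
  | zero => simp [Real.zero_rpow hd.ne']
  | succ k ih =>
    rw [Finset.sum_range_succ]
    set x : ℝ := (k : ℝ) + 1 with hx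
    have hx0 : 0 < x := by positivity
    have hx1 : 1 ≤ x := by rw [hx]; linarith [k.cast_nonneg (α := ℝ)]
    have hb : (1 + -x⁻¹) ^ (1 - δ) ≤ 1 + (1 - δ) * -x⁻¹ :=
      rpow_one_add_le_one_add_mul_self (by linarith [inv_le_one_of_one_le₀ hx1]) hd.le
        (by linarith)
    have hk : (k : ℝ) = x * (1 + -x⁻¹) := by field_simp; rw [hx]; ring
    have hkp : (k : ℝ) ^ (1 - δ) = x ^ (1 - δ) * (1 + -x⁻¹) ^ (1 - δ) := by
      rw [hk, Real.mul_rpow hx0.le (by linarith [inv_le_one_of_one_le₀ hx1])]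
    have hxd : x ^ (-δ) = x ^ (1 - δ) * x⁻¹ := by
      rw [← Real.rpow_neg_one x, ← Real.rpow_add hx0]; congr 1; ring
    have hpos : 0 < x ^ (1 - δ) := by positivity
    rw [le_div_iff₀ hd] at ih ⊢
    push_cast
    rw [← hx, add_mul, hxd]
    nlinarith [mul_le_mul_of_nonneg_left hb hpos.le]

/-- Growth of a chain of points with steps `π + O(‖s k‖ ^ (-δ))`. -/
theorem chain_growth {s : ℕ → ℂ} (hre : ∀ k, 0 ≤ (s k).re)
    (hstep : ∀ k, ‖s (k + 1) - s k - Real.pi‖ ≤ 1 / 10) (k : ℕ) :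
    3 * (k : ℝ) ≤ (s k).re := by
  induction k with
  | zero => simpa using hre 0
  | succ k ih =>
    have := abs_le.1 (abs_re_im_sub_pi_le (hstep k)).1
    push_cast
    linarith [this.1, Real.pi_gt_d2]

/-- The imaginary part moves only by the error of each step, and `‖s k‖ ≥ (k + 1) / 2`; `h0` secures
this at `k = 0`. The sum is left unevaluated because its growth depends on `δ`. -/
theorem chain_im_le {s : ℕ → ℂ} {K δ : ℝ} (hK : 0 < K) (hδ : 0 < δ) (hre : ∀ k, 0 ≤ (s k).re)
    (h0 : 1 ≤ (s 0).re + |(s 0).im|)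
    (hstep : ∀ k, ‖s (k + 1) - s k - Real.pi‖ ≤ 1 / 10)
    (hstep' : ∀ k, ‖s (k + 1) - s k - Real.pi‖ ≤ K * ‖s k‖ ^ (-δ)) :
    ∃ B : ℝ, 0 < B ∧ ∀ k, |(s k).im| ≤ B * (1 + ∑ i ∈ Finset.range k, ((i : ℝ) + 1) ^ (-δ)) := by
  have hn : ∀ k : ℕ, ((k : ℝ) + 1) / 2 ≤ ‖s k‖ := by
    intro k
    rcases Nat.eq_zero_or_pos k with rfl | hk
    · have h1 := (Complex.abs_re_le_norm (s 0))
      have h2 := (Complex.abs_im_le_norm (s 0))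
      rw [abs_of_nonneg (hre 0)] at h1
      simp only [Nat.cast_zero, zero_add]
      linarith
    · have h1 := chain_growth hre hstep k
      have h2 : (1 : ℝ) ≤ k := by exact_mod_cast hk
      linarith [Complex.re_le_norm (s k)]
  refine ⟨|(s 0).im| + K * 2 ^ δ, by positivity, fun k => ?_⟩
  have hS : ∀ k : ℕ, 0 ≤ ∑ i ∈ Finset.range k, ((i : ℝ) + 1) ^ (-δ) := fun k =>
    Finset.sum_nonneg fun i _ => by positivity
  have key : |(s k).im| ≤ |(s 0).im| +
      K * 2 ^ δ * ∑ i ∈ Finset.range k, ((i : ℝ) + 1) ^ (-δ) := by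
    induction k with
    | zero => simp
    | succ k ih =>
      rw [Finset.sum_range_succ, mul_add]
      have h1 := (abs_re_im_sub_pi_le (hstep' k)).2
      have h2 := abs_sub_abs_le_abs_sub (s (k + 1)).im (s k).im
      have h3 : ‖s k‖ ^ (-δ) ≤ 2 ^ δ * ((k : ℝ) + 1) ^ (-δ) := by
        have h4 : ‖s k‖ ^ (-δ) ≤ (((k : ℝ) + 1) / 2) ^ (-δ) :=
          Real.rpow_le_rpow_of_nonpos (by positivity) (hn k) (by linarith)
        rwa [Real.div_rpow (by positivity) zero_le_two, Real.rpow_neg zero_le_two,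
          div_inv_eq_mul, mul_comm] at h4
      have h5 := mul_le_mul_of_nonneg_left h3 hK.le
      linarith
  have h6 := hS k
  have h7 : 0 ≤ K * 2 ^ δ := by positivity
  nlinarith [abs_nonneg (s 0).im]

/-- A chain with decaying perturbation is asymptotic to `π k`. -/
theorem chain_tendsto {s : ℕ → ℂ} {K δ : ℝ} (hδ : 0 < δ) (hre : ∀ k, 0 ≤ (s k).re)
    (hstep : ∀ k, ‖s (k + 1) - s k - Real.pi‖ ≤ 1 / 10)
    (hstep' : ∀ k, ‖s (k + 1) - s k - Real.pi‖ ≤ K * ‖s k‖ ^ (-δ)) :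
    Tendsto (fun k : ℕ => ‖s k‖ / k) atTop (nhds Real.pi) := by
  have hn : Tendsto (fun k => ‖s k‖) atTop atTop := by
    refine tendsto_atTop_mono (f := fun k : ℕ => (k : ℝ)) (fun k => ?_) tendsto_natCast_atTop_atTop
    have h1 := chain_growth hre hstep k
    have h2 : (0 : ℝ) ≤ k := k.cast_nonneg
    linarith [Complex.re_le_norm (s k)]
  have h0 : Tendsto (fun k => s (k + 1) - s k - Real.pi) atTop (nhds 0) := by
    refine squeeze_zero_norm hstep' ?_
    simpa using ((tendsto_rpow_neg_atTop hδ).comp hn).const_mul K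
  have h1 : Tendsto (fun k => s (k + 1) - s k) atTop (nhds (Real.pi : ℂ)) := by
    simpa using h0.add_const (Real.pi : ℂ)
  -- The increments tend to `π`, hence so do their Cesàro means, which telescope to `(s k - s 0) /
  -- k`.
  have h2 := h1.cesaro_smul
  simp only [Finset.sum_range_sub] at h2
  have h3 : Tendsto (fun k : ℕ => (k : ℝ)⁻¹ • s 0) atTop (nhds 0) := by
    simpa using (tendsto_inv_atTop_nhds_zero_nat (𝕜 := ℝ)).smul_const (s 0)
  have h4 := (h2.add h3).norm
  simp only [← smul_add, sub_add_cancel, add_zero, norm_smul, Complex.norm_real] at h4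
  rw [Real.norm_of_nonneg Real.pi_pos.le] at h4
  refine h4.congr fun k => ?_
  rw [norm_inv, Real.norm_of_nonneg (Nat.cast_nonneg k), div_eq_inv_mul]

theorem abs_arg_le_of_re_nonneg {ζ : ℂ} (h : 0 ≤ ζ.re) : |Complex.arg ζ| ≤ 2 * |ζ.im| / ‖ζ‖ := by
  have hpi : |Complex.arg ζ| ≤ Real.pi / 2 := Complex.abs_arg_le_pi_div_two_iff.2 h
  have h1 := Real.mul_abs_le_abs_sin hpi
  rw [Complex.sin_arg, abs_div, abs_norm] at h1
  have h2 : |Complex.arg ζ| / 2 ≤ 2 / Real.pi * |Complex.arg ζ| := by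
    rw [div_mul_eq_mul_div, div_le_div_iff₀ two_pos Real.pi_pos]
    nlinarith [Real.pi_le_four, abs_nonneg (Complex.arg ζ)]
  rw [mul_div_assoc]
  linarith

/-- The arguments of a chain decay at the rate `e_n`. -/
theorem chain_arg_le {n : ℕ} (hn : 1 ≤ n) {s : ℕ → ℂ} {K κ : ℝ} (hK : 0 < K) (hκ : 0 < κ)
    (hre : ∀ k, 0 ≤ (s k).re) (h0 : 1 ≤ (s 0).re + |(s 0).im|)
    (hstep : ∀ k, ‖s (k + 1) - s k - Real.pi‖ ≤ 1 / 10)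
    (hstep' : ∀ k, ‖s (k + 1) - s k - Real.pi‖ ≤ K * ‖s k‖ ^ (-(4 / ((n : ℝ) + 2)))) :
    ∃ A : ℝ, 0 < A ∧ ∀ᶠ k in atTop,
      |Complex.arg (s k)| ≤ A * rate n (κ * ‖s k‖ ^ (2 / ((n : ℝ) + 2))) := by
  set δ : ℝ := 4 / ((n : ℝ) + 2) with hδd
  have hδ : 0 < δ := by positivity
  have hδa : 2 / ((n : ℝ) + 2) = δ / 2 := by rw [hδd]; ring
  rw [hδa]
  obtain ⟨B, hB, him⟩ := chain_im_le hK hδ hre h0 hstep hstep'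
  have hnk : ∀ k : ℕ, (k : ℝ) ≤ ‖s k‖ := by
    intro k
    have h1 := chain_growth hre hstep k
    have h2 : (0 : ℝ) ≤ k := k.cast_nonneg
    linarith [Complex.re_le_norm (s k)]
  have hntop : Tendsto (fun k => ‖s k‖) atTop atTop :=
    tendsto_atTop_mono hnk tendsto_natCast_atTop_atTop
  suffices hmain : ∃ A : ℝ, 0 < A ∧ ∀ᶠ k in atTop,
      |(s k).im| ≤ A * (‖s k‖ * rate n (κ * ‖s k‖ ^ (δ / 2))) by
    obtain ⟨A, hA, hev⟩ := hmain
    refine ⟨2 * A, by positivity, ?_⟩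
    filter_upwards [hev, hntop.eventually_gt_atTop 0] with k hk hpos
    refine (abs_arg_le_of_re_nonneg (hre k)).trans ?_
    rw [div_le_iff₀ hpos]
    linarith
  -- Here `δ` is `4/3`, `1`, or less than `1`: the sum converges, is harmonic, or grows like
  -- `k^(1-δ)`. In each case this matches `‖s k‖ e_n(r)` at `r = κ ‖s k‖^(δ/2)`.
  rcases lt_trichotomy n 2 with hn2 | hn2 | hn2
  · obtain rfl : n = 1 := by omega
    have hδ1 : δ = 4 / 3 := by rw [hδd]; norm_num
    have hsum : Summable fun i : ℕ => ((i : ℝ) + 1) ^ (-δ) := by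
      have := (summable_nat_add_iff 1).2 (Real.summable_nat_rpow.2 (by rw [hδ1]; norm_num : -δ < -1))
      simpa using this
    set T := ∑' i : ℕ, ((i : ℝ) + 1) ^ (-δ) with hT
    have hT0 : 0 ≤ T := tsum_nonneg fun i => by positivity
    refine ⟨B * (1 + T) * κ ^ (3 / 2 : ℝ), by positivity, ?_⟩
    filter_upwards [hntop.eventually_gt_atTop 0] with k hpos
    have hr : ‖s k‖ * rate 1 (κ * ‖s k‖ ^ (δ / 2)) = κ ^ (-(3 / 2) : ℝ) := by
      simp only [rate]
      norm_num
      rw [Real.mul_rpow hκ.le (by positivity), ← Real.rpow_mul hpos.le]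
      norm_num
      rw [Real.rpow_neg_one]
      field_simp
    rw [hr, mul_assoc, ← Real.rpow_add hκ, add_neg_cancel, Real.rpow_zero, mul_one]
    refine (him k).trans (mul_le_mul_of_nonneg_left ?_ hB.le)
    linarith [hsum.sum_le_tsum (Finset.range k) (fun i _ => by positivity)]
  · subst hn2
    have hδ1 : δ = 1 := by rw [hδd]; norm_num
    have hl : Tendsto (fun k => Real.log ‖s k‖) atTop atTop := Real.tendsto_log_atTop.comp hntop
    refine ⟨B * 12 * κ ^ (2 : ℝ), by positivity, ?_⟩
    -- This threshold lets `log ‖s k‖ / 2` absorb `log κ` inside `log r`.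
    filter_upwards [hntop.eventually_gt_atTop 0, hl.eventually_ge_atTop (4 * |Real.log κ| + 1),
      eventually_ge_atTop 1] with k hpos hL hk
    have hsum : ∑ i ∈ Finset.range k, ((i : ℝ) + 1) ^ (-δ) ≤ 1 + Real.log ‖s k‖ := by
      have h1 := harmonic_le_one_add_log k
      have h2 : ((harmonic k : ℚ) : ℝ) = ∑ i ∈ Finset.range k, ((i : ℝ) + 1) ^ (-δ) := by
        rw [harmonic, hδ1]
        push_cast
        refine Finset.sum_congr rfl fun i _ => ?_
        rw [Real.rpow_neg_one]
      have h3 : Real.log k ≤ Real.log ‖s k‖ :=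
        Real.log_le_log (by exact_mod_cast hk) (hnk k)
      linarith
    have hr : ‖s k‖ * rate 2 (κ * ‖s k‖ ^ (δ / 2)) =
        κ ^ (-2 : ℝ) * (Real.log κ + Real.log ‖s k‖ / 2) := by
      simp only [rate, lt_irrefl, if_false, if_true]
      rw [Real.mul_rpow hκ.le (by positivity), ← Real.rpow_mul hpos.le, hδ1,
        Real.log_mul hκ.ne' (by positivity), Real.log_rpow hpos]
      norm_num
      rw [Real.rpow_neg_one]
      field_simp
    rw [hr]
    have e : B * 12 * κ ^ (2 : ℝ) * (κ ^ (-2 : ℝ) * (Real.log κ + Real.log ‖s k‖ / 2)) =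
        B * (12 * (Real.log κ + Real.log ‖s k‖ / 2)) * (κ ^ (2 : ℝ) * κ ^ (-2 : ℝ)) := by ring
    rw [e, ← Real.rpow_add hκ, add_neg_cancel, Real.rpow_zero, mul_one]
    refine (him k).trans (mul_le_mul_of_nonneg_left ?_ hB.le)
    calc _ ≤ 1 + (1 + Real.log ‖s k‖) := by gcongr
      _ ≤ _ := by linarith [neg_abs_le (Real.log κ), abs_nonneg (Real.log κ)]
  · have hδ1 : δ < 1 := by
      rw [hδd, div_lt_one (by positivity)]
      have : (2 : ℝ) < n := by exact_mod_cast hn2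
      linarith
    have hd : 0 < 1 - δ := by linarith
    refine ⟨B * (1 + 1 / (1 - δ)) * κ ^ (2 : ℝ), by positivity, ?_⟩
    filter_upwards [hntop.eventually_ge_atTop 1] with k hpos
    have hpos0 : 0 < ‖s k‖ := by linarith
    have hr : ‖s k‖ * rate n (κ * ‖s k‖ ^ (δ / 2)) = κ ^ (-2 : ℝ) * ‖s k‖ ^ (1 - δ) := by
      simp only [rate, hn2, if_true]
      rw [Real.mul_rpow hκ.le (by positivity), ← Real.rpow_mul hpos0.le, Real.rpow_sub hpos0,
        Real.rpow_one, show δ / 2 * (-2) = -δ by ring, Real.rpow_neg hpos0.le]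
      field_simp
    rw [hr]
    have e : B * (1 + 1 / (1 - δ)) * κ ^ (2 : ℝ) * (κ ^ (-2 : ℝ) * ‖s k‖ ^ (1 - δ)) =
        B * (‖s k‖ ^ (1 - δ) + ‖s k‖ ^ (1 - δ) / (1 - δ)) * (κ ^ (2 : ℝ) * κ ^ (-2 : ℝ)) := by ring
    rw [e, ← Real.rpow_add hκ, add_neg_cancel, Real.rpow_zero, mul_one]
    refine (him k).trans (mul_le_mul_of_nonneg_left ?_ hB.le)
    refine add_le_add (Real.one_le_rpow hpos hd.le) ((sum_rpow_neg_le hδ.le hδ1 k).trans ?_)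
    gcongr
    exact hnk k

/-! ### Zeros of entire solutions -/

namespace IsNontrivialSolution

variable {P : Polynomial ℂ} {f : ℂ → ℂ}

theorem analyticAt (h : IsNontrivialSolution P f) (z : ℂ) : AnalyticAt ℂ f z :=
  h.entire.analyticAt z

theorem analyticOrderAt_ne_top (h : IsNontrivialSolution P f) (z : ℂ) :
    analyticOrderAt f z ≠ ⊤ := by
  intro htop
  obtain ⟨w, hw⟩ := h.nontrivial
  have han : AnalyticOnNhd ℂ f Set.univ := fun z _ => h.analyticAt z
  exact hw (han.eqOn_zero_of_preconnected_of_eventuallyEq_zero isPreconnected_univ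
    (Set.mem_univ z) (analyticOrderAt_eq_top.1 htop) (Set.mem_univ w))

/-- All zeros of a nontrivial solution are simple. -/
theorem deriv_ne_zero (h : IsNontrivialSolution P f) {z : ℂ} (hz : f z = 0) : deriv f z ≠ 0 := by
  intro hd
  have h1 := (h.analyticAt z).analyticOrderAt_deriv_add_one
  have h2 := (h.analyticAt z).deriv.analyticOrderAt_deriv_add_one
  simp only [hz, hd, sub_zero] at h1 h2
  -- At a common zero of `f` and `f'` the order of `f''` is two less than that of `f`, yet `f'' = -P
  -- f` makes it at least as large.
  have h3 : deriv (deriv f) = (fun z => -P.eval z) * f := by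
    funext w
    have := h.ode w
    simp only [Pi.mul_apply]
    linear_combination this
  have hPan : AnalyticAt ℂ (fun z => -P.eval z) z :=
    (P.differentiable.neg).analyticAt z
  rw [h3, analyticOrderAt_mul hPan (h.analyticAt z)] at h2
  have hne := h.analyticOrderAt_ne_top z
  have e : analyticOrderAt (fun z => -P.eval z) z + analyticOrderAt f z + 1 + 1 =
      analyticOrderAt f z := by rw [h2]; exact h1
  lift analyticOrderAt f z to ℕ using hne with m
  cases hp : analyticOrderAt (fun z => -P.eval z) z with
  | top => rw [hp] at e; simp at e
  | coe p =>
    rw [hp] at e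
    norm_cast at e
    omega

theorem analyticOrderNatAt_eq_one (h : IsNontrivialSolution P f) {z : ℂ} (hz : f z = 0) :
    analyticOrderNatAt f z = 1 := by
  rw [analyticOrderNatAt,
    (h.analyticAt z).analyticOrderAt_eq_one_of_zero_deriv_ne_zero hz (h.deriv_ne_zero hz)]
  rfl

theorem finite_zeros_inter_closedBall (h : IsNontrivialSolution P f) (r : ℝ) :
    ({z | f z = 0} ∩ Metric.closedBall 0 r).Finite := by
  have han : AnalyticOnNhd ℂ f Set.univ := fun z _ => h.analyticAt z
  obtain ⟨w, hw⟩ := h.nontrivial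
  have hcod := han.preimage_zero_mem_codiscrete hw
  have hdis := codiscreteWithin_iff_locallyFiniteComplementWithin.1 hcod
  by_contra hinf
  obtain ⟨x, -, hx⟩ := Set.Infinite.exists_accPt_of_subset_isCompact hinf
    (isCompact_closedBall (0 : ℂ) r) Set.inter_subset_right
  obtain ⟨t, ht, hfin⟩ := hdis x (Set.mem_univ x)
  rw [accPt_iff_frequently_nhdsNE] at hx
  have h1 : ∀ᶠ y in nhdsWithin x {x}ᶜ, f y ≠ 0 := by
    have hfin' := hfin.subset (Set.sdiff_subset (t := {x}))
    have h2 : ((t ∩ (Set.univ \ f ⁻¹' {0}ᶜ)) \ {x})ᶜ ∈ nhds x :=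
      hfin'.isClosed.isOpen_compl.mem_nhds (by simp)
    filter_upwards [nhdsWithin_le_nhds h2, nhdsWithin_le_nhds (by simpa using ht),
      self_mem_nhdsWithin] with y hy hyt hyx hy0
    exact hy ⟨⟨hyt, by simp [hy0]⟩, hyx⟩
  exact (hx.and_eventually h1).exists.elim fun y hy => hy.2 hy.1.1

end IsNontrivialSolution

/-! ### The Liouville transformation -/

section Transformation

variable {P : Polynomial ℂ}

/-- After the shift by `c`, the coefficient of order `n - 1` vanishes. -/
theorem exists_norm_eval_sub_shift_le (hn : 1 ≤ P.natDegree) :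
    ∃ K : ℝ, 0 ≤ K ∧ ∀ w : ℂ, 1 ≤ ‖w‖ →
      ‖P.eval (w - criticalShift P) - P.leadingCoeff * w ^ P.natDegree‖ * ‖w‖ ^ 2 ≤
        K * ‖w‖ ^ P.natDegree := by
  set n := P.natDegree with hnd
  set c := criticalShift P with hc
  have hlc : P.leadingCoeff ≠ 0 := by
    rw [Polynomial.leadingCoeff_ne_zero]
    rintro rfl
    simp at hnd
    omega
  set T := Polynomial.taylor (-c) P - Polynomial.C P.leadingCoeff * Polynomial.X ^ n with hT
  have heval : ∀ w : ℂ, T.eval w = P.eval (w - c) - P.leadingCoeff * w ^ n := by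
    intro w
    simp [hT, Polynomial.taylor_eval, sub_eq_add_neg]
  -- Degree `n` cancels by subtraction. In degree `n - 1` the Taylor coefficient is `p_{n-1} - c n
  -- p_n = 0` by the choice of `c`.
  have hcoeff : ∀ i, T.coeff i ≠ 0 → i + 2 ≤ n := by
    intro i hi
    by_contra hlt
    apply hi
    rcases lt_trichotomy i n with hin | hin | hin
    · have him : i + 1 = n := by omega
      have hdeg : (Polynomial.hasseDeriv i P).natDegree < 2 := by
        have := Polynomial.natDegree_hasseDeriv_le P i
        omega
      have hn0 : (n : ℂ) ≠ 0 := by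
        have : n ≠ 0 := by omega
        exact_mod_cast this
      have hc' : c * (n * P.leadingCoeff) = P.coeff i := by
        rw [hc, criticalShift, ← hnd, show n - 1 = i by omega]
        field_simp
      rw [hT, Polynomial.coeff_sub, Polynomial.coeff_C_mul_X_pow, if_neg hin.ne, sub_zero,
        Polynomial.taylor_coeff, Polynomial.eval_eq_sum_range' hdeg, Finset.sum_range_succ,
        Finset.sum_range_one, Polynomial.hasseDeriv_coeff, Polynomial.hasseDeriv_coeff]
      have h1 : P.coeff (1 + i) = P.leadingCoeff := by
        rw [show 1 + i = n by omega]; rfl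
      have h2 : ((1 + i).choose i : ℂ) = n := by
        rw [add_comm, Nat.choose_succ_self_right, him]
      rw [h1, h2, zero_add, Nat.choose_self, ← hc']
      ring
    · rw [hT, Polynomial.coeff_sub, Polynomial.coeff_C_mul_X_pow, if_pos hin, hin, hnd,
        Polynomial.coeff_taylor_natDegree, sub_self]
    · rw [hT, Polynomial.coeff_sub, Polynomial.coeff_C_mul_X_pow, if_neg hin.ne', sub_zero]
      apply Polynomial.coeff_eq_zero_of_natDegree_lt
      rwa [Polynomial.natDegree_taylor]
  refine ⟨∑ i ∈ T.support, ‖T.coeff i‖, Finset.sum_nonneg fun i _ => norm_nonneg _, fun w hw => ?_⟩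
  rw [← heval, Polynomial.eval_eq_sum, Polynomial.sum, Finset.sum_mul]
  refine (mul_le_mul_of_nonneg_right (norm_sum_le _ _) (by positivity)).trans ?_
  rw [Finset.sum_mul]
  refine Finset.sum_le_sum fun i hi => ?_
  rw [norm_mul, norm_pow, mul_assoc, ← pow_add]
  have := hcoeff i (Polynomial.mem_support_iff.1 hi)
  gcongr

theorem hasDerivAt_cpow_div {ζ : ℂ} (hζ : ζ ∈ Complex.slitPlane) (a : ℂ) :
    HasDerivAt (fun ζ : ℂ => ζ ^ a) (a * ζ ^ a / ζ) ζ := by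
  have h0 := Complex.slitPlane_ne_zero hζ
  have := (hasDerivAt_id ζ).cpow_const (c := a) hζ
  simp only [id, mul_one] at this
  convert this using 1
  rw [Complex.cpow_sub _ _ h0, Complex.cpow_one, mul_div_assoc]

/-- The exponent `2 / (n + 2)` of the change of variable `z + c = κ ζ ^ a`. -/
noncomputable def liouvilleExponent (n : ℕ) : ℝ := 2 / ((n : ℝ) + 2)

/-- The Liouville transform of `f`. -/
noncomputable def liouvilleTransform (P : Polynomial ℂ) (f : ℂ → ℂ) (κ ζ : ℂ) : ℂ :=
  ζ ^ (((1 - liouvilleExponent P.natDegree) / 2 : ℝ) : ℂ) *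
    f (κ * ζ ^ (liouvilleExponent P.natDegree : ℂ) - criticalShift P)

theorem cpow_liouvilleExponent_pow (n : ℕ) (ζ : ℂ) :
    (ζ ^ (liouvilleExponent n : ℂ)) ^ (n + 2) = ζ ^ 2 := by
  rw [← Complex.cpow_nat_mul, liouvilleExponent]
  have : ((n + 2 : ℕ) : ℂ) * ((2 / ((n : ℝ) + 2) : ℝ) : ℂ) = (2 : ℕ) := by
    have h : ((n : ℂ) + 2) ≠ 0 := by exact_mod_cast (by omega : n + 2 ≠ 0)
    push_cast
    field_simp
  rw [this, Complex.cpow_natCast]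

/-- With `w = κ ζ^a`, the leading term of `P` contributes exactly `1`, because `(ζ^a)^(n+2) = ζ²`
and by the normalisation of `κ`. The remaining terms of `P` are smaller by `|w|^(-2)`, a multiple of
`|ζ|^(-4/(n+2))`; the weight adds only `O(|ζ|^(-2))`. -/
theorem IsNontrivialSolution.exists_isOscillator {f : ℂ → ℂ} (hf : IsNontrivialSolution P f)
    (hn : 1 ≤ P.natDegree) {κ : ℂ}
    (hκ : κ ^ (P.natDegree + 2) * (liouvilleExponent P.natDegree : ℂ) ^ 2 * P.leadingCoeff = 1) :
    ∃ (φ G₁ : ℂ → ℂ) (K ρ₀ : ℝ), 0 < K ∧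
      IsOscillator φ (liouvilleTransform P f κ) G₁ Complex.slitPlane ∧
      ∀ ζ ∈ Complex.slitPlane, ρ₀ ≤ ‖ζ‖ →
        ‖φ ζ‖ ≤ K * ‖ζ‖ ^ (-(4 / ((P.natDegree : ℝ) + 2))) := by
  set n := P.natDegree with hnd
  set a := liouvilleExponent n with ha
  set b : ℝ := (1 - a) / 2 with hb
  set c := criticalShift P with hc
  have ha0 : 0 < a := by rw [ha, liouvilleExponent]; positivity
  have ha1 : a ≤ 1 := by
    rw [ha, liouvilleExponent, div_le_one (by positivity)]
    linarith [n.cast_nonneg (α := ℝ)]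
  have hκ0 : κ ≠ 0 := by
    rintro rfl
    simp at hκ
  obtain ⟨K, hK, hbound⟩ := exists_norm_eval_sub_shift_le hn
  rw [← hnd, ← hc] at hbound
  set X : ℂ → ℂ := fun ζ => κ * ζ ^ (a : ℂ) - c with hX
  -- This relation cancels the first-derivative term and dictates the exponent `b` of the weight.
  have hab : (2 * b + a - 1 : ℂ) = 0 := by rw [hb]; push_cast; ring
  refine ⟨fun ζ => (κ ^ 2 * a ^ 2 * (ζ ^ (a : ℂ)) ^ 2 * P.eval (X ζ) + b - b ^ 2) / ζ ^ 2 - 1,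
    fun ζ => (b * ζ ^ (b : ℂ) * f (X ζ) + κ * a * ζ ^ (a : ℂ) * ζ ^ (b : ℂ) * deriv f (X ζ)) / ζ,
    ?_⟩
  have hXd : ∀ ζ ∈ Complex.slitPlane, HasDerivAt X (κ * (a * ζ ^ (a : ℂ) / ζ)) ζ := fun ζ hζ =>
    ((hasDerivAt_cpow_div hζ a).const_mul κ).sub_const c
  have hfX : ∀ ζ ∈ Complex.slitPlane,
      HasDerivAt (fun ζ => f (X ζ)) (deriv f (X ζ) * (κ * (a * ζ ^ (a : ℂ) / ζ))) ζ :=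
    fun ζ hζ => (hf.entire (X ζ)).hasDerivAt.comp ζ (hXd ζ hζ)
  have hfX' : ∀ ζ ∈ Complex.slitPlane, HasDerivAt (fun ζ => deriv f (X ζ))
      (-(P.eval (X ζ) * f (X ζ)) * (κ * (a * ζ ^ (a : ℂ) / ζ))) ζ := by
    intro ζ hζ
    have h1 := ((hf.analyticAt (X ζ)).deriv.differentiableAt).hasDerivAt
    rw [eq_neg_of_add_eq_zero_left (hf.ode (X ζ))] at h1
    exact h1.comp ζ (hXd ζ hζ)
  have hosc : IsOscillator
      (fun ζ => (κ ^ 2 * a ^ 2 * (ζ ^ (a : ℂ)) ^ 2 * P.eval (X ζ) + b - b ^ 2) / ζ ^ 2 - 1)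
      (liouvilleTransform P f κ)
      (fun ζ => (b * ζ ^ (b : ℂ) * f (X ζ) + κ * a * ζ ^ (a : ℂ) * ζ ^ (b : ℂ) * deriv f (X ζ)) / ζ)
      Complex.slitPlane := by
    refine ⟨fun ζ hζ => ?_, fun ζ hζ => ?_, fun ζ hζ h0 h1 => ?_⟩
    · have h0 := Complex.slitPlane_ne_zero hζ
      have := (hasDerivAt_cpow_div hζ b).mul (hfX ζ hζ)
      refine HasDerivAt.congr_deriv (f := liouvilleTransform P f κ) this ?_
      field_simp
    · have h0 := Complex.slitPlane_ne_zero hζ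
      have h1 := (((hasDerivAt_cpow_div hζ b).const_mul (b : ℂ)).mul (hfX ζ hζ)).add
        ((((hasDerivAt_cpow_div hζ a).const_mul (κ * a)).mul (hasDerivAt_cpow_div hζ b)).mul
          (hfX' ζ hζ))
      have h2 := h1.div (hasDerivAt_id ζ) h0
      refine HasDerivAt.congr_deriv h2 ?_
      symm
      change _ = (_ * ζ - (b * ζ ^ (b : ℂ) * f (X ζ) +
        κ * a * ζ ^ (a : ℂ) * ζ ^ (b : ℂ) * deriv f (X ζ)) * 1) / ζ ^ 2
      change -((1 + ((κ ^ 2 * a ^ 2 * (ζ ^ (a : ℂ)) ^ 2 * P.eval (X ζ) + b - b ^ 2) / ζ ^ 2 - 1)) *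
        (ζ ^ (b : ℂ) * f (X ζ))) = _
      simp only [Pi.mul_apply]
      generalize ζ ^ (a : ℂ) = y
      generalize ζ ^ (b : ℂ) = u
      generalize f (X ζ) = F
      generalize deriv f (X ζ) = F'
      generalize Polynomial.eval (X ζ) P = p
      field_simp
      linear_combination (-(κ * a * y * u * F')) * hab
    · have hζ0 := Complex.slitPlane_ne_zero hζ
      have hu : ζ ^ (b : ℂ) ≠ 0 := by simp [Complex.cpow_eq_zero_iff, hζ0]
      have hy : ζ ^ (a : ℂ) ≠ 0 := by simp [Complex.cpow_eq_zero_iff, hζ0]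
      have hF : f (X ζ) = 0 := (mul_eq_zero.1 h0).resolve_left hu
      rw [div_eq_zero_iff, or_iff_left hζ0, hF, mul_zero, zero_add] at h1
      have ha0' : (a : ℂ) ≠ 0 := by exact_mod_cast ha0.ne'
      exact hf.deriv_ne_zero hF ((mul_eq_zero.1 h1).resolve_left
        (mul_ne_zero (mul_ne_zero (mul_ne_zero hκ0 ha0') hy) hu))
  have hlim : Tendsto (fun x : ℝ => ‖κ‖ * x ^ a) atTop atTop :=
    (tendsto_rpow_atTop ha0).const_mul_atTop (norm_pos_iff.2 hκ0)
  obtain ⟨ρ, hρ⟩ := (hlim.eventually_ge_atTop 1).exists_forall_of_atTop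
  refine ⟨a ^ 2 * K * ‖κ‖ ^ n + 1, max ρ 1, by positivity, hosc, fun ζ hζ hge => ?_⟩
  have hζ0 := Complex.slitPlane_ne_zero hζ
  have hζ1 : 1 ≤ ‖ζ‖ := (le_max_right _ _).trans hge
  have hζpos : 0 < ‖ζ‖ := by linarith
  set y := ζ ^ (a : ℂ) with hy
  have hynorm : ‖y‖ = ‖ζ‖ ^ a := Complex.norm_cpow_real ζ a
  have hypow : y ^ (n + 2) = ζ ^ 2 := cpow_liouvilleExponent_pow n ζ
  have hw1 : 1 ≤ ‖κ * y‖ := by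
    rw [norm_mul, hynorm]
    exact hρ _ ((le_max_left _ _).trans hge)
  have hw := hbound _ hw1
  set t := P.eval (κ * y - c) - P.leadingCoeff * (κ * y) ^ n with ht
  have hP : P.eval (κ * y - c) = t + P.leadingCoeff * (κ * y) ^ n := by rw [ht]; ring
  have hφ : (κ ^ 2 * a ^ 2 * y ^ 2 * P.eval (X ζ) + b - b ^ 2) / ζ ^ 2 - 1 =
      a ^ 2 * (t * (κ * y) ^ 2 / ζ ^ 2) + (b - b ^ 2 : ℝ) / ζ ^ 2 := by
    change (κ ^ 2 * a ^ 2 * y ^ 2 * P.eval (κ * y - c) + b - b ^ 2) / ζ ^ 2 - 1 = _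
    rw [hP]
    push_cast
    field_simp
    linear_combination (y ^ (n + 2)) * hκ + hypow
  have hypos : 0 < ‖y‖ := by rw [hynorm]; positivity
  have hyn : ‖y‖ ^ (n + 2) = ‖ζ‖ ^ 2 := by rw [← norm_pow, hypow, norm_pow]
  have hexp : ‖ζ‖ ^ (-(4 / ((n : ℝ) + 2))) = (‖y‖ ^ 2)⁻¹ := by
    rw [hynorm, ← Real.rpow_natCast, ← Real.rpow_mul hζpos.le, ← Real.rpow_neg hζpos.le, ha,
      liouvilleExponent]
    congr 1
    push_cast
    ring
  simp only
  rw [hφ, hexp]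
  refine (norm_add_le _ _).trans ?_
  rw [add_mul, one_mul]
  refine add_le_add ?_ ?_
  · rw [norm_mul, norm_div, norm_mul, norm_pow, norm_pow, norm_pow, Complex.norm_real,
      Real.norm_of_nonneg ha0.le, ← hyn]
    rw [norm_mul] at hw ⊢
    rw [mul_assoc, mul_assoc]
    refine mul_le_mul_of_nonneg_left ?_ (by positivity)
    rw [div_le_iff₀ (by positivity)]
    refine hw.trans (le_of_eq ?_)
    field_simp
    ring
  · rw [norm_div, Complex.norm_real, norm_pow, div_le_iff₀ (by positivity)]
    have hb1 : ‖b - b ^ 2‖ ≤ 1 := by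
      rw [Real.norm_eq_abs, abs_le, hb]
      constructor <;> nlinarith
    have hle : ‖y‖ ^ 2 ≤ ‖ζ‖ ^ 2 := by
      have : ‖y‖ ≤ ‖ζ‖ := by
        rw [hynorm]
        exact (Real.rpow_le_rpow_of_exponent_le hζ1 ha1).trans (Real.rpow_one _).le
      gcongr
    refine hb1.trans ?_
    rw [← div_eq_inv_mul, le_div_iff₀ (by positivity), one_mul]
    exact hle

end Transformation

/-! ### Counting functions -/

theorem exists_bounds_of_tendsto_div {u : ℕ → ℝ} {L L₁ L₂ : ℝ} (h1 : L₁ < L) (h2 : L < L₂)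
    (hu : Tendsto (fun k : ℕ => u k / k) atTop (nhds L)) :
    ∃ k₀ : ℕ, ∀ k ≥ k₀, L₁ * k ≤ u k ∧ u k ≤ L₂ * k := by
  obtain ⟨k₀, hk₀⟩ := ((hu.eventually_const_lt h1).and
    ((hu.eventually_lt_const h2).and (eventually_ge_atTop 1))).exists_forall_of_atTop
  refine ⟨k₀, fun k hk => ?_⟩
  obtain ⟨a, b, c⟩ := hk₀ k hk
  have hk0 : (0 : ℝ) < k := by exact_mod_cast c
  exact ⟨((lt_div_iff₀ hk0).1 a).le, ((div_lt_iff₀ hk0).1 b).le⟩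

theorem setOf_le_subset_range {u : ℕ → ℝ} {L₁ : ℝ} {k₀ : ℕ} (hL₁ : 0 < L₁)
    (h : ∀ k ≥ k₀, L₁ * k ≤ u k) (x : ℝ) :
    {k | u k ≤ x} ⊆ (Finset.range (k₀ + (⌊x / L₁⌋₊ + 1)) : Set ℕ) := by
  intro k hk
  simp only [Finset.coe_range, Set.mem_Iio]
  rcases lt_or_ge k k₀ with hlt | hge
  · omega
  · have : (k : ℝ) ≤ x / L₁ := by
      rw [le_div_iff₀ hL₁, mul_comm]
      exact (h k hge).trans hk
    have := Nat.le_floor this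
    omega

theorem finite_setOf_le {u : ℕ → ℝ} {L : ℝ} (hL : 0 < L)
    (hu : Tendsto (fun k : ℕ => u k / k) atTop (nhds L)) (x : ℝ) : {k | u k ≤ x}.Finite := by
  obtain ⟨k₀, hk₀⟩ := exists_bounds_of_tendsto_div (half_lt_self hL) (lt_add_one L) hu
  exact (Finset.finite_toSet _).subset (setOf_le_subset_range (half_pos hL)
    (fun k hk => (hk₀ k hk).1) x)

/-- If `u k / k → L > 0`, the counting function of `u` is asymptotic to `x / L`. -/
theorem tendsto_ncard_setOf_le {u : ℕ → ℝ} {L : ℝ} (hL : 0 < L)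
    (hu : Tendsto (fun k : ℕ => u k / k) atTop (nhds L)) :
    Tendsto (fun x : ℝ => ({k | u k ≤ x}.ncard : ℝ) / x) atTop (nhds L⁻¹) := by
  have hinv : Tendsto (fun y : ℝ => y⁻¹) (nhds L) (nhds L⁻¹) := (continuousAt_inv₀ hL.ne')
  rw [tendsto_order]
  constructor
  · intro a ha
    obtain ⟨L₂, hL₂, haL⟩ : ∃ L₂, L < L₂ ∧ a < L₂⁻¹ := by
      have h1 : ∀ᶠ y in nhdsWithin L (Set.Ioi L), a < y⁻¹ :=
        nhdsWithin_le_nhds (hinv.eventually_const_lt ha)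
      obtain ⟨y, hy, hy'⟩ := (h1.and self_mem_nhdsWithin).exists
      exact ⟨y, hy', hy⟩
    have hL₂0 : 0 < L₂ := hL.trans hL₂
    obtain ⟨k₀, hk₀⟩ := exists_bounds_of_tendsto_div (half_lt_self hL) hL₂ hu
    have hlim : Tendsto (fun x : ℝ => L₂⁻¹ - k₀ / x) atTop (nhds L₂⁻¹) := by
      simpa using tendsto_const_nhds.sub (tendsto_const_nhds.div_atTop (tendsto_id (α := ℝ)))
    filter_upwards [hlim.eventually_const_lt haL, eventually_gt_atTop 0] with x hx hx0
    refine hx.trans_le ?_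
    rw [le_div_iff₀ hx0, sub_mul, div_mul_cancel₀ _ hx0.ne']
    have hsub : (Finset.Ico k₀ (⌊x / L₂⌋₊ + 1) : Set ℕ) ⊆ {k | u k ≤ x} := by
      intro k hk
      simp only [Finset.coe_Ico, Set.mem_Ico] at hk
      have h1 := (hk₀ k hk.1).2
      have h2 : (k : ℝ) ≤ x / L₂ := (Nat.le_floor_iff (by positivity)).1 (by omega)
      rw [le_div_iff₀ hL₂0] at h2
      exact h1.trans (by linarith)
    have hcard := Set.ncard_le_ncard hsub (finite_setOf_le hL hu x)
    rw [Set.ncard_coe_finset, Nat.card_Ico] at hcard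
    have h3 : ((⌊x / L₂⌋₊ + 1 : ℕ) : ℝ) ≤ ({k | u k ≤ x}.ncard + k₀ : ℕ) := by
      exact_mod_cast (by omega)
    have h4 := Nat.lt_floor_add_one (x / L₂)
    push_cast at h3
    rw [div_eq_inv_mul] at h4 h3
    linarith
  · intro a ha
    obtain ⟨L₁, hL₁, hL₁0, haL⟩ : ∃ L₁, L₁ < L ∧ 0 < L₁ ∧ L₁⁻¹ < a := by
      have h1 : ∀ᶠ y in nhdsWithin L (Set.Iio L), y⁻¹ < a :=
        nhdsWithin_le_nhds (hinv.eventually_lt_const ha)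
      have h2 : ∀ᶠ y in nhdsWithin L (Set.Iio L), 0 < y := nhdsWithin_le_nhds (lt_mem_nhds hL)
      obtain ⟨y, hy, hy', hy''⟩ := (h1.and (h2.and self_mem_nhdsWithin)).exists
      exact ⟨y, hy'', hy', hy⟩
    obtain ⟨k₀, hk₀⟩ := exists_bounds_of_tendsto_div hL₁ (lt_add_one L) hu
    have hlim : Tendsto (fun x : ℝ => L₁⁻¹ + (k₀ + 1) / x) atTop (nhds L₁⁻¹) := by
      simpa using tendsto_const_nhds.add (tendsto_const_nhds.div_atTop (tendsto_id (α := ℝ)))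
    filter_upwards [hlim.eventually_lt_const haL, eventually_gt_atTop 0] with x hx hx0
    refine lt_of_le_of_lt ?_ hx
    rw [div_le_iff₀ hx0, add_mul, div_mul_cancel₀ _ hx0.ne']
    have hcard := Set.ncard_le_ncard (setOf_le_subset_range hL₁0 (fun k hk => (hk₀ k hk).1) x)
      (Finset.finite_toSet _)
    rw [Set.ncard_coe_finset, Finset.card_range] at hcard
    have h3 : ({k | u k ≤ x}.ncard : ℝ) ≤ ((k₀ + (⌊x / L₁⌋₊ + 1) : ℕ) : ℝ) := by
      exact_mod_cast hcard
    have h4 := Nat.floor_le (by positivity : 0 ≤ x / L₁)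
    push_cast at h3
    rw [div_eq_inv_mul] at h4 h3
    linarith

/-- The counting function of a set which agrees with a sequence up to finitely many points. -/
theorem ncard_inter_closedBall_isEquivalent {A : Set ℂ} {z : ℕ → ℂ} {q L : ℝ} (hq : 0 < q)
    (hL : 0 < L) (hinj : Function.Injective z) (h1 : (A \ Set.range z).Finite)
    (h2 : (Set.range z \ A).Finite)
    (hz : Tendsto (fun k : ℕ => ‖z k‖ ^ q / k) atTop (nhds L)) :
    (fun r : ℝ => ((A ∩ Metric.closedBall 0 r).ncard : ℝ)) ~[atTop] fun r => L⁻¹ * r ^ q := by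
  set c : ℝ → ℝ := fun r => ({k | ‖z k‖ ^ q ≤ r ^ q}.ncard : ℝ) with hc
  have hcl : Tendsto (fun r => c r / r ^ q) atTop (nhds L⁻¹) :=
    (tendsto_ncard_setOf_le hL hz).comp (tendsto_rpow_atTop hq)
  set D : ℝ := ((A \ Set.range z).ncard : ℝ) + ((Set.range z \ A).ncard : ℝ) with hD
  have hdiff : ∀ r : ℝ, 0 ≤ r → |((A ∩ Metric.closedBall 0 r).ncard : ℝ) - c r| ≤ D := by
    intro r hr
    have hfin : {k | ‖z k‖ ^ q ≤ r ^ q}.Finite := finite_setOf_le hL hz _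
    have himg : z '' {k | ‖z k‖ ^ q ≤ r ^ q} = Set.range z ∩ Metric.closedBall 0 r := by
      ext w
      simp only [Set.mem_image, Set.mem_ofPred_eq, Set.mem_inter_iff, Set.mem_range,
        mem_closedBall_zero_iff]
      constructor
      · rintro ⟨k, hk, rfl⟩
        exact ⟨⟨k, rfl⟩, (Real.rpow_le_rpow_iff (norm_nonneg _) hr hq).1 hk⟩
      · rintro ⟨⟨k, rfl⟩, hk⟩
        exact ⟨k, Real.rpow_le_rpow (norm_nonneg _) hk hq.le, rfl⟩
    have hcard : c r = ((Set.range z ∩ Metric.closedBall 0 r).ncard : ℝ) := by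
      rw [← himg, Set.ncard_image_of_injective _ hinj]
    have hBfin : (Set.range z ∩ Metric.closedBall 0 r).Finite := himg ▸ hfin.image z
    have hsub1 : A ∩ Metric.closedBall 0 r ⊆
        (A \ Set.range z) ∪ (Set.range z ∩ Metric.closedBall 0 r) := by
      rintro w ⟨hwA, hwr⟩
      by_cases hw : w ∈ Set.range z
      · exact Or.inr ⟨hw, hwr⟩
      · exact Or.inl ⟨hwA, hw⟩
    have hsub2 : Set.range z ∩ Metric.closedBall 0 r ⊆
        (Set.range z \ A) ∪ (A ∩ Metric.closedBall 0 r) := by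
      rintro w ⟨hwA, hwr⟩
      by_cases hw : w ∈ A
      · exact Or.inr ⟨hw, hwr⟩
      · exact Or.inl ⟨hwA, hw⟩
    have hAfin := (h1.union hBfin).subset hsub1
    have e1 := (Set.ncard_le_ncard hsub1 (h1.union hBfin)).trans (Set.ncard_union_le _ _)
    have e2 := (Set.ncard_le_ncard hsub2 (h2.union hAfin)).trans (Set.ncard_union_le _ _)
    have e1' : ((A ∩ Metric.closedBall 0 r).ncard : ℝ) ≤
        (A \ Set.range z).ncard + (Set.range z ∩ Metric.closedBall 0 r).ncard := by
      exact_mod_cast e1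
    have e2' : ((Set.range z ∩ Metric.closedBall 0 r).ncard : ℝ) ≤
        (Set.range z \ A).ncard + (A ∩ Metric.closedBall 0 r).ncard := by
      exact_mod_cast e2
    have p1 : (0 : ℝ) ≤ (A \ Set.range z).ncard := Nat.cast_nonneg _
    have p2 : (0 : ℝ) ≤ (Set.range z \ A).ncard := Nat.cast_nonneg _
    rw [hcard, hD, abs_le]
    constructor <;> linarith
  have hrem : Tendsto (fun r : ℝ => (((A ∩ Metric.closedBall 0 r).ncard : ℝ) - c r) / r ^ q) atTop
      (nhds 0) := by
    have hlim : Tendsto (fun r : ℝ => D / r ^ q) atTop (nhds 0) :=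
      tendsto_const_nhds.div_atTop (tendsto_rpow_atTop hq)
    refine squeeze_zero_norm' ?_ hlim
    filter_upwards [eventually_gt_atTop 0] with r hr
    have : 0 < r ^ q := by positivity
    rw [norm_div, Real.norm_eq_abs, Real.norm_of_nonneg this.le]
    gcongr
    exact hdiff r hr.le
  refine isEquivalent_of_tendsto_one ?_
  have := (hcl.add hrem).mul_const L
  rw [add_zero, inv_mul_cancel₀ hL.ne'] at this
  refine this.congr' ?_
  filter_upwards [eventually_gt_atTop 0] with r hr
  have : r ^ q ≠ 0 := (by positivity : 0 < r ^ q).ne'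
  simp only [Pi.div_apply]
  field_simp
  ring

/-- The logarithmic integral of a monotone function of regular growth. -/
theorem integral_div_isEquivalent {N : ℝ → ℝ} {M q t₀ : ℝ} (hM : 0 < M) (hq : 0 < q) (ht₀ : 0 < t₀)
    (hmono : Monotone N) (hzero : ∀ t ≤ t₀, N t = 0)
    (h : N ~[atTop] fun t => M * t ^ q) :
    (fun r : ℝ => ∫ t in (0 : ℝ)..r, N t / t) ~[atTop] fun r => M / q * r ^ q := by
  have hint : ∀ a b : ℝ, IntervalIntegrable (fun t => N t / t) MeasureTheory.volume a b := by
    intro a b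
    -- Since `N` vanishes up to `t₀`, the singular factor `1/t` may be replaced by a continuous one.
    have e : (fun t => N t / t) = fun t => N t * (max t t₀)⁻¹ := by
      funext t
      rcases le_total t t₀ with ht | ht
      · simp [hzero t ht]
      · rw [max_eq_left ht, div_eq_mul_inv]
    rw [e]
    refine (hmono.intervalIntegrable).mul_continuousOn (Continuous.continuousOn ?_)
    exact (continuous_id.max continuous_const).inv₀ fun t => (lt_max_of_lt_right ht₀).ne'
  have hintg : ∀ a b : ℝ, IntervalIntegrable (fun t : ℝ => M * t ^ (q - 1))
      MeasureTheory.volume a b := fun a b =>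
    (intervalIntegral.intervalIntegrable_rpow' (by linarith)).const_mul M
  have hIg : ∀ a b : ℝ, ∫ t in a..b, M * t ^ (q - 1) = M / q * (b ^ q - a ^ q) := by
    intro a b
    rw [intervalIntegral.integral_const_mul, integral_rpow (Or.inl (by linarith)), sub_add_cancel]
    ring
  rw [IsEquivalent, isLittleO_iff]
  intro ε hε
  have hlit := isLittleO_iff.1 h.isLittleO (half_pos hε)
  obtain ⟨T₀, hT₀⟩ := hlit.exists_forall_of_atTop
  set T := max T₀ 1 with hT
  have hT1 : 1 ≤ T := le_max_right _ _
  -- The part up to `T` is a constant, swamped by `r^q`; beyond `T` the integrand has relative error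
  -- at most `ε / 2`.
  set D := ∫ t in (0 : ℝ)..T, (N t / t - M * t ^ (q - 1)) with hD
  have hlim : Tendsto (fun r : ℝ => ε / 2 * (M / q) * r ^ q) atTop atTop :=
    (tendsto_rpow_atTop hq).const_mul_atTop (by positivity)
  filter_upwards [hlim.eventually_ge_atTop ‖D‖, eventually_ge_atTop T] with r hr hrT
  have hr0 : 0 < r := by linarith
  have hsplit : (∫ t in (0 : ℝ)..r, N t / t) - M / q * r ^ q =
      D + ∫ t in T..r, (N t / t - M * t ^ (q - 1)) := by
    rw [hD, intervalIntegral.integral_add_adjacent_intervals ((hint _ _).sub (hintg _ _))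
      ((hint _ _).sub (hintg _ _)), intervalIntegral.integral_sub (hint _ _) (hintg _ _), hIg,
      Real.zero_rpow hq.ne', sub_zero]
  have htail : ‖∫ t in T..r, (N t / t - M * t ^ (q - 1))‖ ≤
      ∫ t in T..r, ε / 2 * (M * t ^ (q - 1)) := by
    refine intervalIntegral.norm_integral_le_of_norm_le hrT (Eventually.of_forall fun t ht => ?_)
      ((hintg _ _).const_mul _)
    have ht0 : 0 < t := by linarith [ht.1]
    have h1 := hT₀ t ((le_max_left _ _).trans ht.1.le)
    simp only [Pi.sub_apply] at h1
    have e1 : N t / t - M * t ^ (q - 1) = (N t - M * t ^ q) / t := by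
      rw [Real.rpow_sub ht0, Real.rpow_one]; ring
    have e2 : ε / 2 * (M * t ^ (q - 1)) = ε / 2 * ‖M * t ^ q‖ / t := by
      rw [Real.rpow_sub ht0, Real.rpow_one, Real.norm_of_nonneg (by positivity)]; ring
    rw [e1, e2, norm_div, Real.norm_of_nonneg ht0.le]
    gcongr
  rw [intervalIntegral.integral_const_mul, hIg] at htail
  simp only [Pi.sub_apply]
  rw [hsplit, Real.norm_of_nonneg (by positivity : 0 ≤ M / q * r ^ q)]
  refine (norm_add_le _ _).trans ?_
  have hTq : 0 ≤ ε / 2 * (M / q) * T ^ q := by positivity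
  nlinarith

namespace IsNontrivialSolution

variable {P : Polynomial ℂ} {f : ℂ → ℂ}

theorem zeroCount_eq_ncard (h : IsNontrivialSolution P f) (S : Set ℂ) (r : ℝ) :
    zeroCount f S r = (({z | f z = 0 ∧ z ∈ S} ∩ Metric.closedBall 0 r).ncard : ℝ) := by
  have hfin : ({z | f z = 0 ∧ z ∈ S} ∩ Metric.closedBall 0 r).Finite :=
    (h.finite_zeros_inter_closedBall r).subset fun z hz => ⟨hz.1.1, hz.2⟩
  have e1 : zeroCount f S r =
      ∑ᶠ z ∈ {z | f z = 0 ∧ z ∈ S} ∩ Metric.closedBall 0 r, (analyticOrderNatAt f z : ℝ) := by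
    rw [zeroCount]
    refine finsum_mem_inter_support_eq' _ _ _ fun z hz => ?_
    have h0 : f z = 0 := apply_eq_zero_of_analyticOrderNatAt_ne_zero (by simpa using hz)
    simp [h0]
  rw [e1, finsum_mem_congr rfl fun z hz => by rw [h.analyticOrderNatAt_eq_one hz.1.1],
    finsum_mem_eq_finite_toFinset_sum _ hfin, Finset.sum_const, Set.ncard_eq_toFinset_card _ hfin]
  simp

end IsNontrivialSolution

/-! ### Critical rays, sectors and thin domains -/

/-- The positive number `t` with `t ^ (n + 2) (2 / (n + 2)) ^ 2 |p_n| = 1`. -/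
noncomputable def rayScale (P : Polynomial ℂ) : ℝ :=
  (liouvilleExponent P.natDegree ^ 2 * ‖P.leadingCoeff‖)⁻¹ ^ (((P.natDegree + 2 : ℕ) : ℝ)⁻¹)

/-- The factor `κ` of the change of variable `z + c = κ ζ ^ (2 / (n + 2))` which maps the right
half-plane to the sector around the `j`-th critical ray. -/
noncomputable def rayFactor (P : Polynomial ℂ) (j : ℕ) : ℂ :=
  rayScale P * Complex.exp (criticalAngle P j * Complex.I)

/-- The zeros of `f` in the closed sector around the `j`-th critical ray. -/
def sectorZeros (P : Polynomial ℂ) (f : ℂ → ℂ) (j : ℕ) : Set ℂ :=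
  {z | f z = 0 ∧ ∃ ζ : ℂ, 0 ≤ ζ.re ∧ ζ ≠ 0 ∧
    z + criticalShift P = rayFactor P j * ζ ^ (liouvilleExponent P.natDegree : ℂ)}

theorem liouvilleExponent_pos (n : ℕ) : 0 < liouvilleExponent n := by
  rw [liouvilleExponent]; positivity

theorem liouvilleExponent_le_one (n : ℕ) : liouvilleExponent n ≤ 1 := by
  rw [liouvilleExponent, div_le_one (by positivity)]
  linarith [n.cast_nonneg (α := ℝ)]

section

variable {P : Polynomial ℂ}

theorem leadingCoeff_ne_zero_of_one_le (hn : 1 ≤ P.natDegree) : P.leadingCoeff ≠ 0 := by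
  rw [Polynomial.leadingCoeff_ne_zero]
  rintro rfl
  simp at hn

theorem rayScale_pos (hn : 1 ≤ P.natDegree) : 0 < rayScale P := by
  have h1 := norm_pos_iff.2 (leadingCoeff_ne_zero_of_one_le hn)
  have h2 := liouvilleExponent_pos P.natDegree
  rw [rayScale]
  positivity

theorem rayScale_pow (hn : 1 ≤ P.natDegree) : rayScale P ^ (P.natDegree + 2) *
    liouvilleExponent P.natDegree ^ 2 * ‖P.leadingCoeff‖ = 1 := by
  have h1 := norm_pos_iff.2 (leadingCoeff_ne_zero_of_one_le hn)
  have h2 := liouvilleExponent_pos P.natDegree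
  rw [rayScale, Real.rpow_inv_natCast_pow (by positivity) (by omega)]
  field_simp

theorem norm_rayFactor (hn : 1 ≤ P.natDegree) (j : ℕ) : ‖rayFactor P j‖ = rayScale P := by
  rw [rayFactor, norm_mul, Complex.norm_exp_ofReal_mul_I, mul_one, Complex.norm_real,
    Real.norm_of_nonneg (rayScale_pos hn).le]

theorem rayFactor_ne_zero (hn : 1 ≤ P.natDegree) (j : ℕ) : rayFactor P j ≠ 0 := by
  rw [← norm_pos_iff, norm_rayFactor hn]
  exact rayScale_pos hn

/-- The critical angle makes `κ^(n+2) p_n` positive, since `(n+2) θ_j + arg p_n = 2πj`; the modulus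
`rayScale P` normalises it. -/
theorem rayFactor_pow (hn : 1 ≤ P.natDegree) (j : ℕ) : rayFactor P j ^ (P.natDegree + 2) *
    (liouvilleExponent P.natDegree : ℂ) ^ 2 * P.leadingCoeff = 1 := by
  have hexp : Complex.exp (criticalAngle P j * Complex.I) ^ (P.natDegree + 2) =
      Complex.exp (-(Complex.arg P.leadingCoeff * Complex.I)) := by
    rw [← Complex.exp_nat_mul, Complex.exp_eq_exp_iff_exists_int]
    refine ⟨j, ?_⟩
    have h : ((P.natDegree : ℂ) + 2) ≠ 0 := by exact_mod_cast (by omega : P.natDegree + 2 ≠ 0)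
    rw [criticalAngle]
    push_cast
    field_simp
    ring
  have h1 := rayScale_pow hn
  have h2 := Complex.norm_mul_exp_arg_mul_I P.leadingCoeff
  rw [rayFactor, mul_pow, hexp]
  calc _ = (rayScale P : ℂ) ^ (P.natDegree + 2) * (liouvilleExponent P.natDegree : ℂ) ^ 2 *
        (Complex.exp (-(Complex.arg P.leadingCoeff * Complex.I)) * P.leadingCoeff) := by ring
    _ = (rayScale P : ℂ) ^ (P.natDegree + 2) * (liouvilleExponent P.natDegree : ℂ) ^ 2 *
        ‖P.leadingCoeff‖ := by
      congr 1
      conv_lhs => rw [← h2]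
      rw [mul_left_comm, ← Complex.exp_add]
      simp
    _ = 1 := by exact_mod_cast h1

/-- Source of the factor `√|p_n| / q` in the counting formulas. -/
theorem rayScale_rpow (hn : 1 ≤ P.natDegree) : rayScale P ^ (((P.natDegree : ℝ) + 2) / 2) =
    (((P.natDegree : ℝ) + 2) / 2) / Real.sqrt ‖P.leadingCoeff‖ := by
  have h1 := norm_pos_iff.2 (leadingCoeff_ne_zero_of_one_le hn)
  have hs := rayScale_pos hn
  have h2 := rayScale_pow hn
  have hsq := Real.sq_sqrt h1.le
  have hsp := Real.sqrt_pos.2 h1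
  rw [← sq_eq_sq₀ (by positivity) (by positivity), ← Real.rpow_natCast, ← Real.rpow_mul hs.le,
    show ((P.natDegree : ℝ) + 2) / 2 * ((2 : ℕ) : ℝ) = ((P.natDegree + 2 : ℕ) : ℝ) by push_cast; ring,
    Real.rpow_natCast, div_pow, hsq]
  rw [liouvilleExponent] at h2
  field_simp at h2 ⊢
  linarith

/-- The sectors around the critical rays cover the plane. -/
theorem exists_mem_sector (hn : 1 ≤ P.natDegree) {w : ℂ} (hw : w ≠ 0) :
    ∃ j < P.natDegree + 2, ∃ ζ : ℂ, 0 ≤ ζ.re ∧ ζ ≠ 0 ∧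
      w = rayFactor P j * ζ ^ (liouvilleExponent P.natDegree : ℂ) := by
  set a := liouvilleExponent P.natDegree with ha
  have ha0 : (a : ℂ) ≠ 0 := by exact_mod_cast (liouvilleExponent_pos P.natDegree).ne'
  -- Of the two square roots one has nonnegative real part. Then `w / (κ_0 ζ^a)` is an `(n+2)`-th
  -- root of unity, and it selects the ray `j`.
  obtain ⟨ζ, hre, hsq⟩ : ∃ ζ : ℂ, 0 ≤ ζ.re ∧
      ζ ^ 2 = w ^ (P.natDegree + 2) * (a : ℂ) ^ 2 * P.leadingCoeff := by
    obtain ⟨ζ, hζ⟩ := IsAlgClosed.exists_pow_nat_eq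
      (w ^ (P.natDegree + 2) * (a : ℂ) ^ 2 * P.leadingCoeff) two_pos
    rcases le_total 0 ζ.re with h | h
    · exact ⟨ζ, h, hζ⟩
    · exact ⟨-ζ, by simpa using h, by rw [neg_sq, hζ]⟩
  have hζ0 : ζ ≠ 0 := by
    rintro rfl
    have := mul_ne_zero (mul_ne_zero (pow_ne_zero (P.natDegree + 2) hw) (pow_ne_zero 2 ha0))
      (leadingCoeff_ne_zero_of_one_le hn)
    rw [← hsq] at this
    simp at this
  have hy0 : ζ ^ (a : ℂ) ≠ 0 := by simp [Complex.cpow_eq_zero_iff, hζ0]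
  have hκ0 := rayFactor_ne_zero hn 0
  have hroot : (w / (rayFactor P 0 * ζ ^ (a : ℂ))) ^ (P.natDegree + 2) = 1 := by
    rw [div_pow, mul_pow, cpow_liouvilleExponent_pow, hsq, div_eq_one_iff_eq]
    · linear_combination (-w ^ (P.natDegree + 2)) * rayFactor_pow hn 0
    · rw [← hsq]
      exact mul_ne_zero (pow_ne_zero _ hκ0) (pow_ne_zero _ hζ0)
  obtain ⟨j, hj, hjw⟩ := (Complex.isPrimitiveRoot_exp (P.natDegree + 2)
    (by omega)).eq_pow_of_pow_eq_one hroot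
  refine ⟨j, hj, ζ, hre, hζ0, ?_⟩
  have hκ : rayFactor P j =
      rayFactor P 0 * Complex.exp (2 * Real.pi * Complex.I / (P.natDegree + 2 : ℕ)) ^ j := by
    rw [rayFactor, rayFactor, mul_assoc, ← Complex.exp_nat_mul, ← Complex.exp_add]
    congr 2
    have h : ((P.natDegree : ℂ) + 2) ≠ 0 := by exact_mod_cast (by omega : P.natDegree + 2 ≠ 0)
    simp only [criticalAngle]
    push_cast
    field_simp
    ring
  rw [hκ, hjw]
  field_simp

theorem cpow_ofReal_eq_polar {ζ : ℂ} (hζ : ζ ≠ 0) (a : ℝ) :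
    ζ ^ (a : ℂ) = (‖ζ‖ ^ a : ℝ) * Complex.exp ((a * Complex.arg ζ : ℝ) * Complex.I) := by
  rw [Complex.cpow_def_of_ne_zero hζ, Real.rpow_def_of_pos (norm_pos_iff.2 hζ), Complex.ofReal_exp,
    ← Complex.exp_add, Complex.log]
  congr 1
  push_cast
  ring

theorem rate_pos (n : ℕ) {r : ℝ} (hr : 1 < r) : 0 < rate n r := by
  have h0 : 0 < r := by linarith
  have := Real.log_pos hr
  rw [rate]
  split_ifs <;> positivity

theorem tendsto_rate (n : ℕ) : Tendsto (rate n) atTop (nhds 0) := by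
  have e : rate n = fun r => rate n r := rfl
  rw [e]
  simp only [rate]
  split_ifs
  · exact tendsto_rpow_neg_atTop two_pos
  · have := (isLittleO_log_rpow_atTop (two_pos : (0 : ℝ) < 2)).tendsto_div_nhds_zero
    refine this.congr' ?_
    filter_upwards [eventually_gt_atTop 0] with r hr
    rw [Real.rpow_neg hr.le, div_eq_inv_mul]
  · exact tendsto_rpow_neg_atTop (by norm_num)

/-- The angular offset from the ray is `a arg ζ`, and `a ≤ 1`. A radius above `1` makes the rate
positive, which gives the strict inequality. -/
theorem mem_shiftedThinDomain {n j : ℕ} (hPn : P.natDegree = n) {z ζ : ℂ} {A C R : ℝ}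
    (hζ : ζ ≠ 0)
    (hz : z + criticalShift P = rayFactor P j * ζ ^ (liouvilleExponent n : ℂ))
    (harg : |Complex.arg ζ| ≤ A * rate n (rayScale P * ‖ζ‖ ^ liouvilleExponent n))
    (hA : A < C) (hR : R < rayScale P * ‖ζ‖ ^ liouvilleExponent n)
    (h1 : 1 < rayScale P * ‖ζ‖ ^ liouvilleExponent n) : z ∈ shiftedThinDomain P C R j := by
  refine ⟨rayScale P * ‖ζ‖ ^ liouvilleExponent n,
    criticalAngle P j + liouvilleExponent n * Complex.arg ζ, ?_, hR, ?_⟩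
  · rw [hz, rayFactor, cpow_ofReal_eq_polar hζ]
    push_cast
    rw [add_mul, Complex.exp_add]
    ring
  · rw [add_sub_cancel_left, abs_mul, abs_of_pos (liouvilleExponent_pos n), hPn]
    have h2 := mul_le_mul_of_nonneg_right (liouvilleExponent_le_one n)
      (abs_nonneg (Complex.arg ζ))
    have h3 := mul_lt_mul_of_pos_right hA (rate_pos n h1)
    linarith

theorem norm_of_mem_thinDomain {C R : ℝ} {j : ℕ} {w : ℂ} (hR : 0 < R)
    (hw : w ∈ thinDomain P C R j) : R < ‖w‖ := by
  obtain ⟨r, θ, rfl, hr, -⟩ := hw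
  rw [norm_mul, Complex.norm_exp_ofReal_mul_I, mul_one, Complex.norm_real,
    Real.norm_of_nonneg (by linarith)]
  exact hr

/-- Distant points of the thin domain lie in the sector. -/
theorem exists_radius_thinDomain_subset_sector (hn : 1 ≤ P.natDegree) {C R : ℝ} (hR : 0 < R)
    (j : ℕ) : ∃ ρ : ℝ, ∀ w ∈ thinDomain P C R j, ρ ≤ ‖w‖ → ∃ ζ : ℂ, 0 ≤ ζ.re ∧ ζ ≠ 0 ∧
      w = rayFactor P j * ζ ^ (liouvilleExponent P.natDegree : ℂ) := by
  set a := liouvilleExponent P.natDegree with ha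
  have ha0 : 0 < a := liouvilleExponent_pos _
  have ht := rayScale_pos hn
  have hlim : Tendsto (fun r => C * rate P.natDegree r) atTop (nhds 0) := by
    simpa using (tendsto_rate P.natDegree).const_mul C
  obtain ⟨ρ, hρ⟩ := (hlim.eventually_le_const ha0).exists_forall_of_atTop
  refine ⟨ρ, ?_⟩
  rintro w ⟨r, θ, rfl, hr, hθ⟩ hw
  have hr0 : 0 < r := by linarith
  rw [norm_mul, Complex.norm_exp_ofReal_mul_I, mul_one, Complex.norm_real,
    Real.norm_of_nonneg hr0.le] at hw
  have hθa := hθ.le.trans (hρ r hw)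
  -- This is the argument of the preimage `ζ`; far out it is at most `1 < π/2` in modulus.
  set α := (θ - criticalAngle P j) / a with hα
  have hα1 : |α| ≤ 1 := by
    rw [hα, abs_div, abs_of_pos ha0, div_le_one ha0]
    exact hθa
  obtain ⟨hα2, hα3⟩ := abs_le.1 hα1
  have hpi := Real.pi_gt_three
  set v : ℂ := (Real.log (r / rayScale P) / a : ℝ) + (α : ℝ) * Complex.I with hv
  have hvim : v.im = α := by simp [hv]
  refine ⟨Complex.exp v, ?_, Complex.exp_ne_zero _, ?_⟩
  · rw [Complex.exp_re, hvim]
    have := Real.cos_nonneg_of_mem_Icc (x := α) ⟨by linarith, by linarith⟩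
    positivity
  · rw [Complex.cpow_def_of_ne_zero (Complex.exp_ne_zero _),
      Complex.log_exp (by rw [hvim]; linarith) (by rw [hvim]; linarith)]
    have haC : (a : ℂ) ≠ 0 := by exact_mod_cast ha0.ne'
    have e1 : v * a = (Real.log (r / rayScale P) : ℝ) +
        (((θ : ℂ) - criticalAngle P j) * Complex.I) := by
      rw [hv, hα]
      push_cast
      field_simp
    have e2 : Complex.exp (Real.log (r / rayScale P) : ℝ) = r / rayScale P := by
      rw [← Complex.ofReal_exp, Real.exp_log (by positivity)]
      push_cast; rfl
    have htC : (rayScale P : ℂ) ≠ 0 := by exact_mod_cast ht.ne'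
    rw [e1, Complex.exp_add, e2, rayFactor]
    have e3 : Complex.exp (θ * Complex.I) = Complex.exp (criticalAngle P j * Complex.I) *
        Complex.exp (((θ : ℂ) - criticalAngle P j) * Complex.I) := by
      rw [← Complex.exp_add]
      congr 1
      ring
    rw [e3]
    field_simp

end

/-! ### Zeros in a sector and the main theorem -/

namespace IsNontrivialSolution

variable {P : Polynomial ℂ} {f : ℂ → ℂ}

theorem finite_of_subset_closedBall (h : IsNontrivialSolution P f) {S : Set ℂ} {r : ℝ}
    (hS : ∀ z ∈ S, f z = 0 ∧ ‖z + criticalShift P‖ ≤ r) : S.Finite := by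
  refine (h.finite_zeros_inter_closedBall (r + ‖criticalShift P‖)).subset fun z hz => ⟨(hS z hz).1, ?_⟩
  rw [mem_closedBall_zero_iff]
  have := norm_sub_le (z + criticalShift P) (criticalShift P)
  rw [add_sub_cancel_right] at this
  linarith [(hS z hz).2]

theorem finite_thinDomain_diff_sectorZeros (h : IsNontrivialSolution P f) (hn : 1 ≤ P.natDegree)
    {C R : ℝ} (hR : 0 < R) (j : ℕ) :
    ({z | f z = 0 ∧ z ∈ shiftedThinDomain P C R j} \ sectorZeros P f j).Finite := by
  obtain ⟨ρ, hρ⟩ := exists_radius_thinDomain_subset_sector (C := C) hn hR j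
  refine h.finite_of_subset_closedBall (r := ρ) ?_
  rintro z ⟨⟨hz, hzd⟩, hzs⟩
  refine ⟨hz, ?_⟩
  by_contra! hlt
  exact hzs ⟨hz, hρ _ hzd hlt.le⟩

/-- The zeros in a sector are finite in number, or they form a sequence of regular growth that
approaches the critical ray, up to finitely many. -/
theorem sectorZeros_finite_or_exists_seq (h : IsNontrivialSolution P f) (hn : 1 ≤ P.natDegree)
    (j : ℕ) :
    (sectorZeros P f j).Finite ∨ ∃ z : ℕ → ℂ, Function.Injective z ∧
      Set.range z ⊆ sectorZeros P f j ∧ (sectorZeros P f j \ Set.range z).Finite ∧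
      Tendsto (fun k : ℕ => ‖z k‖ ^ (((P.natDegree : ℝ) + 2) / 2) / k) atTop
        (nhds ((((P.natDegree : ℝ) + 2) / 2) / Real.sqrt ‖P.leadingCoeff‖ * Real.pi)) ∧
      ∃ A : ℝ, ∀ C R : ℝ, A < C → ∀ᶠ k in atTop, z k ∈ shiftedThinDomain P C R j := by
  set a := liouvilleExponent P.natDegree with ha
  have ha0 : 0 < a := liouvilleExponent_pos _
  set κ := rayFactor P j with hκ
  have hκ0 : κ ≠ 0 := rayFactor_ne_zero hn j
  have hκn : ‖κ‖ = rayScale P := norm_rayFactor hn j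
  have ht := rayScale_pos hn
  obtain ⟨φ, G₁, K, ρ₀, hK, hosc, hφ⟩ := h.exists_isOscillator hn (rayFactor_pow hn j)
  rw [← hκ] at hosc
  obtain ⟨ρ, K', hρ1, hK', hZ⟩ := hosc.exists_chain_rightZeros hK (by positivity) hφ
  set Z := rightZeros (liouvilleTransform P f κ) ρ with hZdef
  set ψ : ℂ → ℂ := fun ζ => κ * ζ ^ (a : ℂ) - criticalShift P with hψ
  have hψn : ∀ ζ : ℂ, ‖ψ ζ + criticalShift P‖ = rayScale P * ‖ζ‖ ^ a := by
    intro ζ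
    simp only [hψ]
    rw [sub_add_cancel, norm_mul, hκn, Complex.norm_cpow_real]
  -- A sector zero missed by `rightZeros` has a preimage of modulus below `ρ`, so such zeros are
  -- bounded and finite in number.
  have hsub : ∀ z ∈ sectorZeros P f j, z ∉ ψ '' Z →
      f z = 0 ∧ ‖z + criticalShift P‖ ≤ rayScale P * ρ ^ a := by
    rintro z ⟨hz, ζ, hre, hζ0, hzζ⟩ hnot
    refine ⟨hz, ?_⟩
    have hzψ : z = ψ ζ := by
      simp only [hψ]
      rw [← hzζ, add_sub_cancel_right]
    by_contra! hlt
    apply hnot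
    refine ⟨ζ, ⟨hre, ?_, ?_⟩, hzψ.symm⟩
    · by_contra! hlt'
      have hle : ‖ζ‖ ≤ ρ := by
        have := Complex.norm_le_abs_re_add_abs_im ζ
        rw [abs_of_nonneg hre] at this
        linarith
      rw [hzψ, hψn] at hlt
      have := mul_le_mul_of_nonneg_left (Real.rpow_le_rpow (norm_nonneg _) hle ha0.le) ht.le
      linarith
    · change _ * f (ψ ζ) = 0
      rw [← hzψ, hz, mul_zero]
  rcases hZ with hempty | ⟨s, hsZ, hs1, hs2, hsfin⟩
  · left
    refine h.finite_of_subset_closedBall fun z hz => hsub z hz ?_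
    simp [hempty]
  right
  have hsre : ∀ k, 0 ≤ (s k).re := fun k => (hsZ k).1
  have hs0 : ∀ k, s k ≠ 0 := by
    intro k h0
    have := (hsZ k).2.1
    rw [h0] at this
    simp at this
    linarith
  have hgrow := chain_growth hsre hs1
  have hmono : StrictMono fun k => (s k).re := by
    refine strictMono_nat_of_lt_succ fun k => ?_
    have := abs_le.1 (abs_re_im_sub_pi_le (hs1 k)).1
    linarith [this.1, Real.pi_gt_three]
  have hδ : (0 : ℝ) < 4 / ((P.natDegree : ℝ) + 2) := by positivity
  have hnormlim : Tendsto (fun k => ‖s k‖) atTop atTop := by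
    refine tendsto_atTop_mono (f := fun k : ℕ => (k : ℝ)) (fun k => ?_) tendsto_natCast_atTop_atTop
    linarith [Complex.re_le_norm (s k), hgrow k, (Nat.cast_nonneg k : (0 : ℝ) ≤ k)]
  have hmodlim : Tendsto (fun k => rayScale P * ‖s k‖ ^ a) atTop atTop :=
    ((tendsto_rpow_atTop ha0).comp hnormlim).const_mul_atTop ht
  refine ⟨fun k => ψ (s k), ?_, ?_, ?_, ?_, ?_⟩
  · intro k l hkl
    have hy : s k ^ (a : ℂ) = s l ^ (a : ℂ) := by
      simp only [hψ] at hkl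
      exact mul_left_cancel₀ hκ0 (sub_left_injective hkl)
    -- `ζ^a` determines `ζ²`. Both real parts are nonnegative, so either sign forces equal real
    -- parts, which increase strictly along the chain.
    have hsq : s k ^ 2 = s l ^ 2 := by
      rw [← cpow_liouvilleExponent_pow P.natDegree, ← cpow_liouvilleExponent_pow P.natDegree, ← ha,
        hy]
    rcases sq_eq_sq_iff_eq_or_eq_neg.1 hsq with he | he
    · exact hmono.injective (congrArg Complex.re he)
    · apply hmono.injective
      have h1 := congrArg Complex.re he
      rw [Complex.neg_re] at h1
      change (s k).re = (s l).re
      linarith [hsre k, hsre l]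
  · rintro _ ⟨k, rfl⟩
    refine ⟨?_, s k, hsre k, hs0 k, by simp [hψ, hκ, ha]⟩
    have hG := (hsZ k).2.2
    rw [liouvilleTransform] at hG
    refine (mul_eq_zero.1 hG).resolve_left ?_
    simp [Complex.cpow_eq_zero_iff, hs0 k]
  · refine ((h.finite_of_subset_closedBall
      (S := sectorZeros P f j \ ψ '' Z) fun z hz => hsub z hz.1 hz.2).union
        (hsfin.image ψ)).subset ?_
    rintro z ⟨hz, hzr⟩
    by_cases hzZ : z ∈ ψ '' Z
    · right
      obtain ⟨ζ, hζ, rfl⟩ := hzZ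
      refine ⟨ζ, ⟨hζ, ?_⟩, rfl⟩
      rintro ⟨k, rfl⟩
      exact hzr ⟨k, rfl⟩
    · exact Or.inl ⟨hz, hzZ⟩
  · set q : ℝ := ((P.natDegree : ℝ) + 2) / 2 with hq
    have haq : a * q = 1 := by
      rw [ha, liouvilleExponent, hq]
      field_simp
    -- The shift is negligible against `κ (s k)^a`; as `a q = 1`, `‖z k‖^q` is asymptotic to `|κ|^q
    -- ‖s k‖`.
    have h1 : Tendsto (fun k => criticalShift P / (κ * s k ^ (a : ℂ))) atTop (nhds 0) := by
      rw [tendsto_zero_iff_norm_tendsto_zero]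
      have : Tendsto (fun k => ‖criticalShift P‖ / (rayScale P * ‖s k‖ ^ a)) atTop (nhds 0) :=
        tendsto_const_nhds.div_atTop hmodlim
      refine this.congr fun k => ?_
      rw [norm_div, norm_mul, hκn, Complex.norm_cpow_real]
    have h2 : Tendsto (fun k => ‖1 - criticalShift P / (κ * s k ^ (a : ℂ))‖ ^ q) atTop
        (nhds 1) := by
      have := ((tendsto_const_nhds (x := (1 : ℂ))).sub h1).norm.rpow_const (p := q)
        (Or.inl (by simp))
      simpa using this
    have h3 := (h2.mul_const (rayScale P ^ q)).mul (chain_tendsto hδ hsre hs1 hs2)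
    rw [one_mul, rayScale_rpow hn] at h3
    refine h3.congr fun k => ?_
    have hyk : κ * s k ^ (a : ℂ) ≠ 0 :=
      mul_ne_zero hκ0 (by simp [Complex.cpow_eq_zero_iff, hs0 k])
    have e : ψ (s k) = (1 - criticalShift P / (κ * s k ^ (a : ℂ))) * (κ * s k ^ (a : ℂ)) := by
      rw [sub_mul, one_mul, div_mul_cancel₀ _ hyk]
    change _ = ‖ψ (s k)‖ ^ q / k
    rw [← rayScale_rpow hn, ← hq, e, norm_mul, norm_mul, hκn, Complex.norm_cpow_real,
      Real.mul_rpow (norm_nonneg _) (by positivity), Real.mul_rpow ht.le (by positivity),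
      ← Real.rpow_mul (norm_nonneg _), haq, Real.rpow_one]
    ring
  · obtain ⟨A, hA, hev⟩ := chain_arg_le hn hK' ht hsre (hρ1.trans (hsZ 0).2.1) hs1 hs2
    refine ⟨A, fun C R hC => ?_⟩
    filter_upwards [hev, hmodlim.eventually_gt_atTop R, hmodlim.eventually_gt_atTop 1] with k h1 h2 h3
    exact mem_shiftedThinDomain rfl (hs0 k) (sub_add_cancel _ _) h1 hC h2 h3

end IsNontrivialSolution

theorem finite_range_diff_of_eventually {z : ℕ → ℂ} {S : Set ℂ} (h : ∀ᶠ k in atTop, z k ∈ S) :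
    (Set.range z \ S).Finite := by
  rw [← Nat.cofinite_eq_atTop, eventually_cofinite] at h
  refine (h.image z).subset ?_
  rintro _ ⟨⟨k, rfl⟩, hk⟩
  exact ⟨k, hk, rfl⟩

/-- Asymptotics of the two counting functions of the zeros in a thin domain. -/
theorem IsNontrivialSolution.zeroCount_isEquivalent {P : Polynomial ℂ} {f : ℂ → ℂ}
    (h : IsNontrivialSolution P f) {S : Set ℂ} {z : ℕ → ℂ} {q M : ℝ} (hq : 0 < q) (hM : 0 < M)
    (hS : ∀ w ∈ S, 1 < ‖w‖) (hinj : Function.Injective z)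
    (h1 : ({w | f w = 0 ∧ w ∈ S} \ Set.range z).Finite)
    (h2 : (Set.range z \ {w | f w = 0 ∧ w ∈ S}).Finite)
    (hz : Tendsto (fun k : ℕ => ‖z k‖ ^ q / k) atTop (nhds M⁻¹)) :
    (fun r : ℝ => zeroCount f S r) ~[atTop] (fun r => M * r ^ q) ∧
      (fun r : ℝ => integratedZeroCount f S r) ~[atTop] fun r => M / q * r ^ q := by
  have hcount : (fun r : ℝ => zeroCount f S r) ~[atTop] fun r => M * r ^ q := by
    have := ncard_inter_closedBall_isEquivalent hq (inv_pos.2 hM) hinj h1 h2 hz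
    simp only [inv_inv] at this
    simpa only [h.zeroCount_eq_ncard] using this
  -- `S` avoids the closed unit disc, so the terms with `n(0)` drop out and the integrand vanishes
  -- near `0`.
  have hzero : ∀ t ≤ (1 : ℝ), zeroCount f S t = 0 := by
    intro t ht
    rw [h.zeroCount_eq_ncard, Nat.cast_eq_zero]
    convert Set.ncard_empty ℂ
    rw [Set.eq_empty_iff_forall_notMem]
    rintro w ⟨⟨-, hw⟩, hwt⟩
    rw [mem_closedBall_zero_iff] at hwt
    linarith [hS w hw]
  have hmono : Monotone fun r : ℝ => zeroCount f S r := by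
    intro r r' hr
    simp only [h.zeroCount_eq_ncard]
    rw [Nat.cast_le]
    refine Set.ncard_le_ncard (Set.inter_subset_inter_right _ (Metric.closedBall_subset_closedBall hr))
      ((h.finite_zeros_inter_closedBall r').subset ?_)
    exact fun w hw => ⟨hw.1.1, hw.2⟩
  refine ⟨hcount, ?_⟩
  simp only [integratedZeroCount, hzero 0 zero_le_one, sub_zero, zero_mul, add_zero]
  exact integral_div_isEquivalent hM hq one_pos hmono hzero hcount

theorem theorem2 :
    ∃ C : ℕ → ℝ → ℝ, (∀ (n : ℕ) (R : ℝ), 0 < C n R) ∧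
      ∀ (n : ℕ) (P : Polynomial ℂ) (f : ℂ → ℂ), 1 ≤ n → P.natDegree = n →
        IsNontrivialSolution P f →
        ∃ R₀ : ℝ, 0 < R₀ ∧ ∀ R : ℝ, R₀ ≤ R →
          {z : ℂ | f z = 0 ∧
            z ∉ ⋃ j ∈ Finset.range (n + 2), shiftedThinDomain P (C n R) R j}.Finite ∧
          ∀ j ∈ Finset.range (n + 2),
            {z : ℂ | f z = 0 ∧ z ∈ shiftedThinDomain P (C n R) R j}.Infinite →
            (fun r : ℝ => zeroCount f (shiftedThinDomain P (C n R) R j) r) ~[atTop]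
              (fun r : ℝ => Real.sqrt ‖P.leadingCoeff‖ / ((((n : ℝ) + 2) / 2) * Real.pi) *
                r ^ (((n : ℝ) + 2) / 2)) ∧
            (fun r : ℝ => integratedZeroCount f (shiftedThinDomain P (C n R) R j) r) ~[atTop]
              (fun r : ℝ => Real.sqrt ‖P.leadingCoeff‖ / ((((n : ℝ) + 2) / 2) ^ 2 * Real.pi) *
                r ^ (((n : ℝ) + 2) / 2)) := by
  -- The constants `A j` depend on `P` and `f`. Taking `R₀` above all of them makes `C = max R 1`
  -- exceed each `A j`; the `1` only ensures positivity for every `R`.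
  refine ⟨fun _ R => max R 1, fun n R => lt_max_of_lt_right one_pos, ?_⟩
  rintro n P f hn rfl hf
  have hsector : ∀ j : ℕ, ∃ A : ℝ, (sectorZeros P f j).Finite ∨ ∃ z : ℕ → ℂ,
      Function.Injective z ∧ Set.range z ⊆ sectorZeros P f j ∧
      (sectorZeros P f j \ Set.range z).Finite ∧
      Tendsto (fun k : ℕ => ‖z k‖ ^ (((P.natDegree : ℝ) + 2) / 2) / k) atTop
        (nhds ((((P.natDegree : ℝ) + 2) / 2) / Real.sqrt ‖P.leadingCoeff‖ * Real.pi)) ∧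
      ∀ C R : ℝ, A < C → ∀ᶠ k in atTop, z k ∈ shiftedThinDomain P C R j := by
    intro j
    rcases hf.sectorZeros_finite_or_exists_seq hn j with hfin | ⟨z, a, b, c, d, A, hA⟩
    · exact ⟨0, Or.inl hfin⟩
    · exact ⟨A, Or.inr ⟨z, a, b, c, d, hA⟩⟩
  choose A hA using hsector
  -- The summand `‖c‖ + 1` keeps the shifted domains outside the closed unit disc.
  refine ⟨∑ j ∈ Finset.range (P.natDegree + 2), |A j| + ‖criticalShift P‖ + 1, by positivity,
    fun R hR => ?_⟩
  have hsum0 : 0 ≤ ∑ j ∈ Finset.range (P.natDegree + 2), |A j| :=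
    Finset.sum_nonneg fun j _ => abs_nonneg _
  have hR1 : 1 + ‖criticalShift P‖ ≤ R := by linarith
  have hR0 : 0 < R := by linarith [norm_nonneg (criticalShift P)]
  have hAC : ∀ j ∈ Finset.range (P.natDegree + 2), A j < max R 1 := by
    intro j hj
    have h1 := Finset.single_le_sum (f := fun j => |A j|) (fun j _ => abs_nonneg _) hj
    refine lt_of_lt_of_le ?_ (le_max_left _ _)
    linarith [le_abs_self (A j), norm_nonneg (criticalShift P)]
  constructor
  · have hfin : (⋃ j ∈ Finset.range (P.natDegree + 2),
        (sectorZeros P f j \ shiftedThinDomain P (max R 1) R j)).Finite := by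
      refine Set.Finite.biUnion (Finset.finite_toSet _) fun j hj => ?_
      rcases hA j with hfin | ⟨z, -, -, hz, -, hev⟩
      · exact hfin.subset Set.sdiff_subset
      · refine (hz.union (finite_range_diff_of_eventually (hev _ R (hAC j hj)))).subset ?_
        rintro w ⟨hw, hwd⟩
        by_cases hwz : w ∈ Set.range z
        · exact Or.inr ⟨hwz, hwd⟩
        · exact Or.inl ⟨hw, hwz⟩
    -- The point `-c` is the common vertex of the sectors and has no preimage `ζ ≠ 0`.
    refine (hfin.union (Set.finite_singleton (-criticalShift P))).subset ?_
    rintro w ⟨hw, hwd⟩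
    by_cases hw0 : w + criticalShift P = 0
    · exact Or.inr (eq_neg_of_add_eq_zero_left hw0)
    · left
      obtain ⟨j, hj, ζ, hζ⟩ := exists_mem_sector hn hw0
      simp only [Set.mem_iUnion, not_exists] at hwd ⊢
      exact ⟨j, Finset.mem_range.2 hj, ⟨hw, ζ, hζ⟩, hwd j (Finset.mem_range.2 hj)⟩
  · intro j hj hinf
    have hdiff := hf.finite_thinDomain_diff_sectorZeros (C := max R 1) hn hR0 j
    rcases hA j with hfin | ⟨z, hinj, hzS, hz, hlim, hev⟩
    · exact absurd ((hdiff.union hfin).subset fun w hw => by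
        by_cases hws : w ∈ sectorZeros P f j
        · exact Or.inr hws
        · exact Or.inl ⟨hw, hws⟩) hinf
    have hlc := norm_pos_iff.2 (leadingCoeff_ne_zero_of_one_le hn)
    have hsq := Real.sqrt_pos.2 hlc
    have hS : ∀ w ∈ shiftedThinDomain P (max R 1) R j, 1 < ‖w‖ := by
      intro w hw
      have h1 := norm_of_mem_thinDomain hR0 hw
      linarith [norm_add_le w (criticalShift P)]
    have hmain := hf.zeroCount_isEquivalent
      (M := Real.sqrt ‖P.leadingCoeff‖ / ((((P.natDegree : ℝ) + 2) / 2) * Real.pi))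
      (q := ((P.natDegree : ℝ) + 2) / 2) (by positivity) (by positivity) hS hinj
      ((hdiff.union hz).subset fun w hw => by
        by_cases hws : w ∈ sectorZeros P f j
        · exact Or.inr ⟨hws, hw.2⟩
        · exact Or.inl ⟨hw.1, hws⟩)
      ((finite_range_diff_of_eventually (hev _ R (hAC j hj))).subset fun w hw =>
        ⟨hw.1, fun hwd => hw.2 ⟨(hzS hw.1).1, hwd⟩⟩)
      (by
        convert hlim using 2
        field_simp)
    refine ⟨hmain.1, ?_⟩
    convert hmain.2 using 2
    field_simp
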